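/- \textbf{Theorem (intersecting prechords).} A \emph{pseudodiagram} is a knot diagram (on the sphere) in which some of the double points, called \emph{precrossings}, carry no over/under information; the other double points are \emph{classical crossings}. A \emph{resolution} of a pseudodiagram is a classical knot diagram obtained by choosing over/under information at every precrossing. The \emph{Gauss diagram} of a pseudodiagram is the circle that parametrizes the curve, together with one chord for each double point, joining its two preimages; a \emph{prechord} is a chord that belongs to a precrossing, and two chords \emph{intersect} if their endpoints alternate on the circle. Two pseudodiagrams are \emph{equivalent} if they are related by a finite sequence of planar isotopies and pseudo-Reidemeister moves: the classical moves R1, R2, R3 (involving classical crossings only), PR1 (create or remove a loop with one precrossing), PR2 (exchange the precrossing and the classical crossing at the two corners of a bigon, the classical crossing keeping its sign), and PR3 (move a strand over, or under, a precrossing). They are \emph{homotopic} if they are related by a finite sequence of these moves and of crossing changes at classical crossings. Let $K$ be a pseudodiagram that has two precrossings whose chords intersect in the Gauss diagram of $K$. Then every pseudodiagram $K'$ that is homotopic to $K$ is nontrivial: $K'$ has a resolution that is a diagram of a nontrivial knot (it is not related to the crossingless diagram of the unknot by classical Reidemeister moves), and $K'$ is not equivalent to the crossingless diagram of the unknot.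 Moreover, the Gauss diagram of $K'$ contains two intersecting prechords. -/

import Mathlib

/-!
Knot diagrams and pseudodiagrams, recorded combinatorially.

A (pseudo)diagram of a knot is a generic closed curve on the oriented sphere, with crossing
information at some of its double points.  Up to orientation preserving homeomorphism, such a curve
is a 4-valent map on the sphere, and it is recorded here as follows.  Name the double points by
natural numbers and travel once around the curve.  At each double point `c` the curve passes twice;
the passes are called `(c, true)` and `(c, false)` so that the direction of travel of `(c, true)`
followed by that of `(c, false)` is a positively oriented frame.  The cyclic list of the passes,
together with these names, determines the curve.
-/

/-- A passage of the curve through a double point: `(c, true)` and `(c, false)` are the two passages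
through the double point `c`, and (direction of `(c, true)`, direction of `(c, false)`) is a
positive frame. -/
abbrev Pass : Type := ℕ × Bool

/-- A dart (half-edge) at a double point: `(p, true)` is the half-edge by which the passage `p`
leaves the double point, `(p, false)` the one by which it arrives. -/
abbrev Dart : Type := Pass × Bool

/-- Each edge joins the outgoing dart of a passage with the incoming dart of the next passage
(`List.formPerm` sends each entry of the list to the next one, cyclically). -/
def edgePerm (w : List Pass) : Equiv.Perm Dart where
  toFun d := if d.2 then (w.formPerm d.1, false) else (w.formPerm.symm d.1, true)
  invFun d := if d.2 then (w.formPerm d.1, false) else (w.formPerm.symm d.1, true)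
  left_inv := by rintro ⟨p, _ | _⟩ <;> simp
  right_inv := by rintro ⟨p, _ | _⟩ <;> simp

/-- Clockwise rotation of the four darts at each double point.  If `(c, true)` travels east and
`(c, false)` travels north, the dart in the west is `((c, true), false)`, the one in the north is
`((c, false), true)`, the one in the east is `((c, true), true)`, and the one in the south is
`((c, false), false)`; they are permuted in this cyclic order. -/
def rotationPerm : Equiv.Perm Dart where
  toFun d := ((d.1.1, !d.1.2), xor d.1.2 d.2)
  invFun d := ((d.1.1, !d.1.2), xor (!d.1.2) d.2)
  left_inv := by rintro ⟨⟨c, _ | _⟩, _ | _⟩ <;> rfl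
  right_inv := by rintro ⟨⟨c, _ | _⟩, _ | _⟩ <;> rfl

/-- The face permutation of the map: run along an edge, then turn left. -/
def facePerm (w : List Pass) : Equiv.Perm Dart := rotationPerm * edgePerm w

/-- The faces of the map (the regions of the complement of the curve), as cycles of the face
permutation. -/
def faces (w : List Pass) : Set (Set Dart) :=
  {F | ∃ d : Dart, d.1 ∈ w ∧ F = {e | (facePerm w).SameCycle d e}}

/-- The map lies on the sphere: `V - E + F = 2`, where `E = w.length` and `V = w.length / 2`.  The
empty list stands for a simple closed curve, without double points. -/
def IsSpherical (w : List Pass) : Prop :=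
  w ≠ [] → w.length / 2 + (faces w).ncard = w.length + 2

/-- A pseudodiagram of a knot. -/
structure Pseudodiagram where
  /-- the passages through the double points, in the order in which they are met -/
  word : List Pass
  /-- `none` for a precrossing; `some s` for a classical crossing at which the passage `(c, s)` is
  the upper one (a positive crossing for `s = true`, a negative one for `s = false`).  Only the
  values at double points of the diagram matter. -/
  info : ℕ → Option Bool
  nodup : word.Nodup
  passedTwice : ∀ (c : ℕ) (s : Bool), (c, s) ∈ word → (c, !s) ∈ word
  spherical : IsSpherical word

namespace Pseudodiagram

/-- The crossingless diagram of the unknot. -/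
def unknot : Pseudodiagram where
  word := []
  info := fun _ => none
  nodup := List.nodup_nil
  passedTwice := by simp
  spherical := fun h => absurd rfl h

/-- `c` is a precrossing of `D`. -/
def IsPrecrossing (D : Pseudodiagram) (c : ℕ) : Prop :=
  (c, true) ∈ D.word ∧ D.info c = none

/-- The chords of `c` and `d` in the Gauss diagram of `D` intersect.  The Gauss diagram has the
passages of `D` placed on a circle in the order of `D.word`, and joins the two passages of each
double point by a chord; two chords intersect when their ends alternate on the circle. -/
def ChordsIntersect (D : Pseudodiagram) (c d : ℕ) : Prop :=
  ∃ s t : Bool, [(c, s), (d, t), (c, !s), (d, !t)].Sublist D.word ∨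
    [(d, t), (c, s), (d, !t), (c, !s)].Sublist D.word

/-- The Gauss diagram of `D` has two intersecting chords that belong to precrossings. -/
def HasIntersectingPrechords (D : Pseudodiagram) : Prop :=
  ∃ c d : ℕ, D.IsPrecrossing c ∧ D.IsPrecrossing d ∧ D.ChordsIntersect c d

/-- The resolution of `D` in which each precrossing `c` becomes a classical crossing with upper
passage `(c, r c)`. -/
def resolve (D : Pseudodiagram) (r : ℕ → Bool) : Pseudodiagram :=
  { D with info := fun c => some ((D.info c).getD (r c)) }

/-- `D` and `D'` record the same unoriented diagram on the sphere: they differ in the starting point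
of the travel, in its direction (this does not affect the frames), or in the names of the double
points. -/
inductive SameDiagram : Pseudodiagram → Pseudodiagram → Prop
  | rotate (D D' : Pseudodiagram) (hw : D'.word ~r D.word) (hi : D'.info = D.info) :
      SameDiagram D D'
  | reverse (D D' : Pseudodiagram) (hw : D'.word = D.word.reverse) (hi : D'.info = D.info) :
      SameDiagram D D'
  | rename (D D' : Pseudodiagram) (f : ℕ → ℕ) (hw : D'.word = D.word.map fun p => (f p.1, p.2))
      (hi : ∀ p ∈ D.word, D'.info (f p.1) = D.info p.1) : SameDiagram D D'

/-- Two strands `p`, `q` that meet in `a` and `b` and there bound a bigon: they run in the same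
direction or in opposite directions, and `p` crosses `q` in `a` and back again in `b`. -/
def Bigon (a b : ℕ) (p q : List Pass) : Prop :=
  ∃ s : Bool, p = [(a, s), (b, !s)] ∧ (q = [(a, !s), (b, s)] ∨ q = [(b, s), (a, !s)])

/-- The strand that passes `x`, then `y`, or the other way round. -/
def strand (e : Bool) (x y : Pass) : List Pass := if e then [x, y] else [y, x]

/-- Three strands `p`, `q`, `r` that bound a triangle, with corners `a` (of `p` and `q`), `b` (of `q`
and `r`) and `c` (of `r` and `p`).  When one runs along the boundary with the triangle on the left,
the sides lie in order on `p`, `q`, `r`, and `e₁`, `e₂`, `e₃` tell whether they are traversed in the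
direction of the strand.  The last condition says that `p` is the upper strand at both its corners,
or the lower strand at both. -/
def Triangle (info : ℕ → Option Bool) (a b c : ℕ) (p q r : List Pass) : Prop :=
  ∃ e₁ e₂ e₃ : Bool,
    p = strand e₁ (c, xor e₃ e₁) (a, !(xor e₁ e₂)) ∧
    q = strand e₂ (a, xor e₁ e₂) (b, !(xor e₂ e₃)) ∧
    r = strand e₃ (b, xor e₂ e₃) (c, !(xor e₃ e₁)) ∧
    ((info c = some (xor e₃ e₁) ∧ info a = some (!(xor e₁ e₂))) ∨
      (info c = some (!(xor e₃ e₁)) ∧ info a = some (xor e₁ e₂)))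

/-- A strand `p` is moved, above or below, across the double point `b` of two other strands. -/
def Slide (b : ℕ) (D D' : Pseudodiagram) : Prop :=
  D'.info = D.info ∧ ∃ (a c : ℕ) (p q r u v w : List Pass), Triangle D.info a b c p q r ∧
    ((D.word = p ++ u ++ q ++ v ++ r ++ w ∧
        D'.word = p.reverse ++ u ++ q.reverse ++ v ++ r.reverse ++ w) ∨
      (D.word = p ++ u ++ r ++ v ++ q ++ w ∧
        D'.word = p.reverse ++ u ++ r.reverse ++ v ++ q.reverse ++ w))

/-- The classical Reidemeister moves, in which only classical crossings take part. -/
inductive ReidemeisterMove : Pseudodiagram → Pseudodiagram → Prop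
  | r1 (D D' : Pseudodiagram) (c : ℕ) (s : Bool) (hi : D'.info = D.info) (hc : D.info c ≠ none)
      (hw : D'.word = [(c, s), (c, !s)] ++ D.word) : ReidemeisterMove D D'
  | r2 (D D' : Pseudodiagram) (a b : ℕ) (o : Bool) (p q u v : List Pass) (hi : D'.info = D.info)
      (ha : D.info a = some o) (hb : D.info b = some (!o)) (hpq : Bigon a b p q)
      (hw : D.word = u ++ v) (hw' : D'.word = p ++ u ++ q ++ v) : ReidemeisterMove D D'
  | r3 (D D' : Pseudodiagram) (b : ℕ) (hb : D.info b ≠ none) (h : Slide b D D') :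
      ReidemeisterMove D D'

/-- The pseudo-Reidemeister moves that involve a precrossing: `pr1` creates a loop with a
precrossing, `pr2` exchanges the precrossing and the classical crossing at the ends of a bigon (the
classical crossing keeps its sign), and `pr3` moves a strand above or below a precrossing. -/
inductive PrecrossingMove : Pseudodiagram → Pseudodiagram → Prop
  | pr1 (D D' : Pseudodiagram) (c : ℕ) (s : Bool) (hi : D'.info = D.info) (hc : D.info c = none)
      (hw : D'.word = [(c, s), (c, !s)] ++ D.word) : PrecrossingMove D D'
  | pr2 (D D' : Pseudodiagram) (a b : ℕ) (p q u v : List Pass) (ha : D.info a = none)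
      (hb : D.info b ≠ none) (hpq : Bigon a b p q) (hw : D.word = p ++ u ++ q ++ v)
      (hw' : D'.word = D.word) (hi : D'.info = D.info ∘ Equiv.swap a b) : PrecrossingMove D D'
  | pr3 (D D' : Pseudodiagram) (b : ℕ) (hb : D.info b = none) (h : Slide b D D') :
      PrecrossingMove D D'

/-- A crossing change at a classical crossing `c`. -/
def CrossingChange (D D' : Pseudodiagram) : Prop :=
  ∃ (c : ℕ) (s : Bool), D.info c = some s ∧ D'.word = D.word ∧
    D'.info = Function.update D.info c (some !s)

/-- Equivalence under the classical Reidemeister moves.  (They neither create nor remove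
precrossings, so for diagrams of classical knots this is the usual equivalence.) -/
def KnotEquiv : Pseudodiagram → Pseudodiagram → Prop :=
  Relation.EqvGen fun D D' => SameDiagram D D' ∨ ReidemeisterMove D D'

/-- Two pseudodiagrams represent the same pseudoknot: they are related by a sequence of
pseudo-Reidemeister moves, which include the classical ones. -/
def PseudoEquiv : Pseudodiagram → Pseudodiagram → Prop :=
  Relation.EqvGen fun D D' => SameDiagram D D' ∨ ReidemeisterMove D D' ∨ PrecrossingMove D D'

/-- Two pseudodiagrams are homotopic: they are related by a sequence of pseudo-Reidemeister moves
and crossing changes. -/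
def Homotopic : Pseudodiagram → Pseudodiagram → Prop :=
  Relation.EqvGen fun D D' =>
    SameDiagram D D' ∨ ReidemeisterMove D D' ∨ PrecrossingMove D D' ∨ CrossingChange D D'

end Pseudodiagram

/-! Two quantities are followed through the moves.

The first is the presence of two intersecting prechords, which is invariant under homotopy. A
crossing change alters neither the chords nor the set of prechords. The chord of an R1 or PR1 loop
meets no other chord. The chords of an R2 bigon are classical, and PR2 exchanges two parallel
chords. A slide changes only the mutual position of three chords, two of which are classical. The
crossingless diagram has no chords, so it is not equivalent to `K'`.

The second is the Arf invariant of a classical diagram, computed from the based Gauss diagram as a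
count modulo 2 of pairs of chords met in the pattern under, over, over, under (`arfSum`). Its
invariance is local combinatorics, except for the choice of the starting point (`arf_rotate_one`):
moving it across a lower passage changes the sum by the number of chords that intersect the chord of
that passage. This number is even because the curve lies on a sphere (`odd_idxOf_of_isSpherical`),
which follows from Euler's formula through the vanishing of the first homology modulo 2
(`sum_eq_one_of_euler`).

Now vary the resolution at two intersecting prechords only. In the sum of the four Arf invariants
every other pair of chords cancels, and the pair itself is counted for exactly one of the four
choices (`sum_arfSum_eq_one`). Hence some resolution has nonzero Arf invariant, while the unknot has
Arf invariant zero. -/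

section Homology

/-! ### Homology modulo 2 of a map on the sphere. -/

open Module

variable {P V F : Type*} [Fintype P] [Fintype V] [Fintype F]

/-- Regroups a sum over passages by double points, each represented by its passage of sign `true`.
-/
theorem sum_eq_sum_filter_add_involution {M : Type*} [AddCommMonoid M] (bar : Equiv.Perm P)
    (hbar : ∀ p, bar (bar p) = p)
    (sgn : P → Bool) (hsgn : ∀ p, sgn (bar p) = !sgn p) (h : P → M) :
    ∑ p, h p = ∑ p with sgn p = true, (h p + h (bar p)) := by
  rw [Finset.sum_add_distrib, ← Finset.sum_filter_add_sum_filter_not Finset.univ (sgn · = true)]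
  congr 1
  refine Finset.sum_bij (fun p _ => bar p) ?_ ?_ ?_ ?_
  · simp [hsgn]
  · intro a _ b _ hab
    exact bar.injective hab
  · intro b hb
    refine ⟨bar b, ?_, hbar b⟩
    simpa [hsgn] using hb
  · simp [hbar]

/-- The coboundary of a function on the faces of a map: its jump across each edge. -/
def faceJump (σ : Equiv.Perm P) (φ : P × Bool → F) : (F → ZMod 2) →ₗ[ZMod 2] (P → ZMod 2) where
  toFun f p := f (φ (p, true)) + f (φ (σ p, false))
  map_add' f g := by ext p; simp only [Pi.add_apply]; ring
  map_smul' a f := by ext p; simp only [Pi.smul_apply, smul_eq_mul, RingHom.id_apply]; ring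

/-- The coboundary of a function on the vertices of a map. -/
def vertexJump (σ : Equiv.Perm P) (π : P → V) : (V → ZMod 2) →ₗ[ZMod 2] (P → ZMod 2) where
  toFun ψ p := ψ (π p) + ψ (π (σ p))
  map_add' f g := by ext p; simp only [Pi.add_apply]; ring
  map_smul' a f := by ext p; simp only [Pi.smul_apply, smul_eq_mul, RingHom.id_apply]; ring

theorem ZMod.two_eq_of_add_eq_zero {a b : ZMod 2} (h : a + b = 0) : a = b := by
  revert a b; decide

/-- The kernel has dimension at most one, so this is rank-nullity. It serves both coboundaries,
whose kernels are constant because the curve is connected. -/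
theorem finrank_range_of_ker_const {ι X : Type*} [Fintype ι] [AddCommGroup X] [Module (ZMod 2) X]
    (T : (ι → ZMod 2) →ₗ[ZMod 2] X) (hT : ∀ f, T f = 0 → ∀ i j, f i = f j) :
    Fintype.card ι ≤ finrank (ZMod 2) (LinearMap.range T) + 1 := by
  have h := LinearMap.finrank_range_add_finrank_ker T
  rw [finrank_fintype_fun_eq_card] at h
  have hk : finrank (ZMod 2) (LinearMap.ker T) ≤ 1 := by
    refine finrank_le_one_iff.2 ?_
    by_cases hz : ∃ v : LinearMap.ker T, v ≠ 0
    · obtain ⟨v, hv⟩ := hz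
      refine ⟨v, fun w => ?_⟩
      have hv' : ∃ i, v.1 i ≠ 0 := by
        by_contra! hcon
        exact hv (Subtype.ext (funext hcon))
      obtain ⟨i, hi⟩ := hv'
      refine ⟨w.1 i, Subtype.ext (funext fun j => ?_)⟩
      have h1 := hT v.1 v.2 i j
      have h2 := hT w.1 w.2 i j
      have h3 : v.1 i = 1 := by
        generalize v.1 i = x at hi; revert x; decide
      simp [← h1, h3, h2]
    · push Not at hz
      exact ⟨0, fun w => ⟨0, by rw [hz w]; simp⟩⟩
  omega

/-- On a map on the sphere (by Euler's formula), a function on the edges that is a cycle up to the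
vertex of `c`, where it switches between the two passes, has odd total. -/
theorem sum_eq_one_of_euler [DecidableEq V] [Nonempty P] (σ : Equiv.Perm P)
    (hσ : ∀ S : P → ZMod 2, (∀ p, S (σ p) = S p) → ∀ p q, S p = S q)
    (bar : Equiv.Perm P) (hbar : ∀ p, bar (bar p) = p)
    (sgn : P → Bool) (hsgn : ∀ p, sgn (bar p) = !sgn p)
    (π : P → V) (hπ : Function.Surjective π) (hfib : ∀ p q, π p = π q ↔ p = q ∨ p = bar q)
    (φ : P × Bool → F) (hφ : Function.Surjective φ)
    (hφ₁ : ∀ p, φ (bar p, sgn p) = φ (σ.symm p, true))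
    (hφ₂ : ∀ p, φ (bar p, !sgn p) = φ (σ p, false))
    (hE : Fintype.card V + Fintype.card F = Fintype.card P + 2)
    (χ : P → ZMod 2) (c : P)
    (hχ : ∀ p, χ p + χ (σ.symm p) = if π p = π c then 1 else 0) :
    ∑ p, χ p = 1 := by
  classical
  have hπbar : ∀ p, π (bar p) = π p := fun p => (hfib _ _).2 (Or.inr rfl)
  have two : ∀ a : ZMod 2, a + a = 0 := by decide
  -- A passage `p` also stands for the edge from `p` to `σ p`. Then `A` consists of the boundaries
  -- of sets of faces, and the orthogonal of `B` consists of the cycles; the aim is that they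
  -- coincide.
  set A := LinearMap.range (faceJump σ φ)
  set B := LinearMap.range (vertexJump σ π)
  let D : LinearMap.BilinForm (ZMod 2) (P → ZMod 2) := Matrix.toBilin' 1
  have hD : ∀ x y, D x y = ∑ p, x p * y p := by
    intro x y
    simp only [D, Matrix.toBilin'_apply', Matrix.one_mulVec, dotProduct]
  have hDn : D.Nondegenerate := by
    refine LinearMap.BilinForm.nondegenerate_toBilin'_of_det_ne_zero' _ ?_
    simp
  have hkA : Fintype.card F ≤ finrank (ZMod 2) A + 1 := by
    refine finrank_range_of_ker_const _ fun f hf => ?_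
    have h0 : ∀ p, f (φ (p, true)) = f (φ (σ p, false)) := fun p =>
      ZMod.two_eq_of_add_eq_zero (congrFun hf p)
    -- The face to the left of the outgoing edge and the face to the right of the incoming edge are
    -- opposite corners at the double point, two jumps apart.
    have h1 : ∀ p, f (φ (p, true)) = f (φ (p, false)) := by
      intro p
      have e1 := congrArg f (hφ₁ (bar p))
      have e2 := congrArg f (hφ₂ (bar p))
      have e5 := congrArg f (hφ₁ p)
      have e6 := congrArg f (hφ₂ p)
      rw [h0, Equiv.apply_symm_apply] at e1 e5
      rw [← h0] at e2 e6
      rw [hbar, hsgn] at e1 e2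
      cases hs : sgn p <;> rw [hs] at e1 e2 e5 e6 <;>
        simp only [Bool.not_true, Bool.not_false] at e1 e2 e5 e6
      · exact e1.trans e5
      · grind
    have h2 := hσ (fun p => f (φ (p, true))) (fun p => by rw [h1, ← h0])
    intro i j
    obtain ⟨⟨p, s⟩, rfl⟩ := hφ i
    obtain ⟨⟨q, t⟩, rfl⟩ := hφ j
    have := h2 p q
    have e1 := h1 p
    have e2 := h1 q
    cases s <;> cases t
    · exact e1.symm.trans (this.trans e2)
    · exact e1.symm.trans this
    · exact this.trans e2
    · exact this
  have hkB : Fintype.card V ≤ finrank (ZMod 2) B + 1 := by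
    refine finrank_range_of_ker_const _ fun f hf => ?_
    have h0 : ∀ p, f (π p) = f (π (σ p)) := fun p =>
      ZMod.two_eq_of_add_eq_zero (congrFun hf p)
    have h2 := hσ (fun p => f (π p)) (fun p => (h0 p).symm)
    intro i j
    obtain ⟨p, rfl⟩ := hπ i
    obtain ⟨q, rfl⟩ := hπ j
    exact h2 p q
  -- Summation by parts along the curve.
  have hshift : ∀ (x : P → ZMod 2) (ψ : V → ZMod 2),
      ∑ p, vertexJump σ π ψ p * x p = ∑ p, ψ (π p) * (x p + x (σ.symm p)) := by
    intro x ψ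
    simp only [vertexJump, LinearMap.coe_mk, AddHom.coe_mk, add_mul, mul_add,
      Finset.sum_add_distrib]
    congr 1
    rw [← Equiv.sum_comp σ (fun p => ψ (π p) * x (σ.symm p))]
    simp
  have hAB : A ≤ D.orthogonal B := by
    rintro _ ⟨f, rfl⟩ _ ⟨ψ, rfl⟩
    rw [hD, hshift,
      sum_eq_sum_filter_add_involution bar hbar sgn hsgn]
    refine Finset.sum_eq_zero fun p _ => ?_
    rw [hπbar, ← mul_add]
    -- The right side is the sum of `f` over the four corners at the double point. It is the same
    -- for both passages, so the two contributions cancel.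
    have key : ∀ p, faceJump σ φ f p + faceJump σ φ f (σ.symm p) =
        f (φ (p, true)) + f (φ (p, false)) + (f (φ (bar p, true)) + f (φ (bar p, false))) := by
      intro p
      simp only [faceJump, LinearMap.coe_mk, AddHom.coe_mk, Equiv.apply_symm_apply, ← hφ₁ p, ← hφ₂ p]
      cases sgn p <;> simp <;> ring
    rw [key, key, hbar, add_comm (f (φ (bar p, true)) + f (φ (bar p, false))), two, mul_zero]
  -- Euler's formula: `|P| - dim B ≤ |P| - |V| + 1 = |F| - 1 ≤ dim A`.
  have hfin : finrank (ZMod 2) (D.orthogonal B) ≤ finrank (ZMod 2) A := by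
    have := LinearMap.BilinForm.finrank_orthogonal hDn B
    rw [finrank_fintype_fun_eq_card] at this
    have hle := Submodule.finrank_le B
    rw [finrank_fintype_fun_eq_card] at hle
    omega
  have heq := Submodule.eq_of_le_of_finrank_le hAB hfin
  have hmem : χ ∈ A := by
    rw [heq]
    rintro _ ⟨ψ, rfl⟩
    rw [hD, hshift,
      sum_eq_sum_filter_add_involution bar hbar sgn hsgn]
    refine Finset.sum_eq_zero fun p _ => ?_
    rw [hχ, hχ, hπbar, two]
  obtain ⟨f, hf⟩ := hmem
  have hf' : ∀ p, χ p = f (φ (p, true)) + f (φ (σ p, false)) := fun p => (congrFun hf p).symm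
  -- `L p` is the value of `f` to the left of the edge `p`. The sum in `hzero` vanishes because
  -- every edge occurs twice; grouped by double points with `hloc`, the same sum is the total of `χ`
  -- plus one, from the double point of `c`.
  set L : P → ZMod 2 := fun p => f (φ (p, true)) with hL
  have hzero : ∑ p, (L p + L (σ.symm p)) = 0 := by
    rw [Finset.sum_add_distrib, Equiv.sum_comp σ.symm L, two]
  have hloc : ∀ p, L p + L (σ.symm p) + (L (bar p) + L (σ.symm (bar p))) =
      χ p + χ (bar p) + if π p = π c then 1 else 0 := by
    intro p
    have e1 := hφ₁ (bar p)
    have e2 := hφ₂ (bar p)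
    have e5 := hφ₁ p
    have e6 := hφ₂ p
    have f1 := hf' p
    have f2 := hf' (bar p)
    have f3 := hf' (σ.symm p)
    have c1 := hχ p
    have c2 := hχ (bar p)
    rw [Equiv.apply_symm_apply] at f3
    rw [hbar, hsgn] at e1 e2
    rw [hπbar] at c2
    simp only [hL]
    rw [← c1, ← e1, ← e5, f1, f2, f3, ← e5, ← e6, ← e2]
    cases sgn p <;> simp <;> grind
  have hc : ∃ c', sgn c' = true ∧ π c' = π c := by
    cases hs : sgn c
    · exact ⟨bar c, by simp [hsgn, hs], hπbar c⟩
    · exact ⟨c, hs, rfl⟩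
  obtain ⟨c', hc', hcc⟩ := hc
  have hone : ∑ p with sgn p = true, (if π p = π c then (1 : ZMod 2) else 0) = 1 := by
    rw [Finset.sum_eq_single c']
    · simp [hcc]
    · intro b hb hne
      simp only [Finset.mem_filter, Finset.mem_univ, true_and] at hb
      rw [if_neg]
      rw [← hcc, hfib]
      rintro (h | h)
      · exact hne h
      · rw [h, hsgn, hc'] at hb
        simp at hb
    · simp [hc']
  rw [sum_eq_sum_filter_add_involution bar hbar sgn hsgn] at hzero
  simp only [hloc] at hzero
  rw [Finset.sum_add_distrib, hone, ← sum_eq_sum_filter_add_involution bar hbar sgn hsgn] at hzero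
  exact ZMod.two_eq_of_add_eq_zero hzero

end Homology

/-! ### Parity of the chords of a spherical curve. -/

theorem formPerm_idxOf {w : List Pass} (hw : w.Nodup) {p : Pass} (hp : p ∈ w) :
    w.idxOf (w.formPerm p) = (w.idxOf p + 1) % w.length := by
  have hi := List.idxOf_lt_length_of_mem hp
  have h := List.formPerm_apply_getElem w hw _ hi
  rw [List.getElem_idxOf] at h
  rw [h, hw.idxOf_getElem]

theorem facePerm_class_eq (w : List Pass) (d : Dart) :
    {e | (facePerm w).SameCycle (facePerm w d) e} = {e | (facePerm w).SameCycle d e} := by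
  ext e
  exact Equiv.Perm.sameCycle_apply_left

theorem facePerm_apply_true (w : List Pass) (p : Pass) :
    facePerm w (p, true) = (((w.formPerm p).1, !(w.formPerm p).2), (w.formPerm p).2) := by
  simp [facePerm, edgePerm, rotationPerm]

theorem facePerm_formPerm_false (w : List Pass) (p : Pass) :
    facePerm w (w.formPerm p, false) = ((p.1, !p.2), !p.2) := by
  simp [facePerm, edgePerm, rotationPerm]

/-- In the Gauss diagram of a curve on the sphere, an even number of passages lies between the two
ends of each chord. -/
theorem odd_idxOf_of_isSpherical {u : List Pass} {c : ℕ} {s : Bool}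
    (hw : ((c, s) :: u).Nodup)
    (ht : ∀ (c' : ℕ) (s' : Bool), (c', s') ∈ (c, s) :: u → (c', !s') ∈ (c, s) :: u)
    (hsph : IsSpherical ((c, s) :: u)) :
    ((((c, s) :: u).idxOf (c, !s) : ℕ) : ZMod 2) = 1 := by
  classical
  have hx0 : ((c, s) :: u).idxOf (c, s) = 0 := List.idxOf_cons_self
  have hxw : (c, s) ∈ (c, s) :: u := List.mem_cons_self
  generalize (c, s) :: u = w at *
  have hyw : (c, !s) ∈ w := ht _ _ hxw
  set k := w.idxOf (c, !s) with hk
  have hkn : k < w.length := List.idxOf_lt_length_of_mem hyw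
  have hinj : ∀ p ∈ w, ∀ q, w.idxOf p = w.idxOf q → p = q := fun p hp q h =>
    (List.idxOf_inj hp).1 h
  have hk0 : k ≠ 0 := by
    intro h
    have := hinj _ hyw (c, s) (by rw [← hk, h, hx0])
    simp at this
  let P := {p // p ∈ w}
  let V := {v // v ∈ (w.map Prod.fst).toFinset}
  have : Nonempty P := ⟨⟨_, hxw⟩⟩
  have hmem : ∀ {p : Pass}, p ∈ w → (p.1, !p.2) ∈ w := fun {p} hp => ht p.1 p.2 hp
  let bar : Equiv.Perm P :=
    { toFun := fun p => ⟨(p.1.1, !p.1.2), hmem p.2⟩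
      invFun := fun p => ⟨(p.1.1, !p.1.2), hmem p.2⟩
      left_inv := fun p => by simp
      right_inv := fun p => by simp }
  let σ : Equiv.Perm P := w.formPerm.subtypePerm fun x => List.formPerm_mem_iff_mem
  have hσv : ∀ p : P, (σ p).1 = w.formPerm p.1 := fun p => rfl
  let π : P → V := fun p => ⟨p.1.1, List.mem_toFinset.2 (List.mem_map_of_mem p.2)⟩
  have hπv : ∀ p q : P, π p = π q ↔ p.1.1 = q.1.1 := fun p q => Subtype.ext_iff
  let φ : P × Bool → faces w :=
    fun d => ⟨{e | (facePerm w).SameCycle (d.1.1, d.2) e}, (d.1.1, d.2), d.1.2, rfl⟩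
  have hφ : Function.Surjective φ := by
    rintro ⟨_, ⟨p, t⟩, hp, rfl⟩
    exact ⟨(⟨p, hp⟩, t), rfl⟩
  have : Finite (faces w) := Finite.of_surjective φ hφ
  have : Fintype (faces w) := Fintype.ofFinite _
  have hP : Fintype.card P = w.length := by
    rw [← List.toFinset_card_of_nodup hw]
    exact Fintype.card_of_subtype _ (by simp)
  have hPV : Fintype.card P = Fintype.card V * 2 := by
    rw [← Fintype.card_bool, ← Fintype.card_prod]
    refine Fintype.card_congr
      { toFun := fun p => (π p, p.1.2)
        invFun := fun x => ⟨(x.1.1, x.2), ?_⟩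
        left_inv := fun p => rfl
        right_inv := fun x => rfl }
    obtain ⟨⟨v, hv⟩, t⟩ := x
    simp only [List.mem_toFinset, List.mem_map, Prod.exists, exists_and_right, exists_eq_right] at hv
    obtain ⟨t', ht'⟩ := hv
    rcases Bool.eq_or_eq_not t t' with h | h
    · rwa [h]
    · rw [h]; exact ht _ _ ht'
  have hEul := hsph (List.ne_nil_of_mem hxw)
  have hmain := sum_eq_one_of_euler σ (fun S hS => by
      have key : ∀ i (hi : i < w.length),
          S ⟨w[i], List.getElem_mem hi⟩ = S ⟨w[0], List.getElem_mem _⟩ := by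
        intro i
        induction i with
        | zero => intro hi; rfl
        | succ i ih =>
          intro hi
          rw [← ih (by omega), ← hS ⟨w[i], _⟩]
          congr 1
          apply Subtype.ext
          rw [hσv]
          have := List.formPerm_apply_getElem w hw i (by omega)
          simp only [Nat.mod_eq_of_lt hi] at this
          exact this.symm
      have key' : ∀ p : P, S p = S ⟨w[0], List.getElem_mem _⟩ := by
        rintro ⟨p, hp⟩
        obtain ⟨i, hi, rfl⟩ := List.getElem_of_mem hp
        exact key i hi
      intro p q
      rw [key' p, key' q])
    bar (fun p => by simp [bar]) (fun p => p.1.2) (fun p => rfl) π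
    (by
      rintro ⟨v, hv⟩
      have hv' := hv
      simp only [List.mem_toFinset, List.mem_map, Prod.exists, exists_and_right, exists_eq_right] at hv'
      obtain ⟨t', ht'⟩ := hv'
      exact ⟨⟨(v, t'), ht'⟩, rfl⟩)
    (by
      rintro ⟨⟨a, s₁⟩, ha⟩ ⟨⟨b, s₂⟩, hb⟩
      rw [hπv, Subtype.ext_iff, Subtype.ext_iff]
      simp only [bar, Equiv.coe_fn_mk, Prod.mk.injEq]
      cases s₁ <;> cases s₂ <;> simp)
    φ hφ
    (by
      intro p
      apply Subtype.ext
      have h := facePerm_class_eq w ((σ.symm p).1, true)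
      have e : w.formPerm (σ.symm p).1 = p.1 := by rw [← hσv, Equiv.apply_symm_apply]
      rwa [facePerm_apply_true, e] at h)
    (by
      intro p
      apply Subtype.ext
      have h := facePerm_class_eq w ((σ p).1, false)
      rwa [hσv, facePerm_formPerm_false] at h)
    (by
      rw [← Nat.card_coe_set_eq, Nat.card_eq_fintype_card] at hEul
      omega)
    -- The indicator of the edges of the loop that runs from the start `(c, s)` to the return `(c,
    -- !s)`. It has `k` edges, and it switches only at positions `0` and `k`.
    (fun p => if w.idxOf p.1 < k then 1 else 0) ⟨(c, s), hxw⟩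
    (by
      intro p
      obtain ⟨q, rfl⟩ := σ.surjective p
      have hq := List.idxOf_lt_length_of_mem q.2
      have h1 := formPerm_idxOf hw q.2
      have h2 : π (σ q) = π ⟨(c, s), hxw⟩ ↔ w.idxOf (σ q).1 = 0 ∨ w.idxOf (σ q).1 = k := by
        rw [← hx0, hk, List.idxOf_inj (σ q).2, List.idxOf_inj (σ q).2]
        rw [hπv]
        obtain ⟨⟨a, t⟩, ha⟩ := σ q
        simp only [Prod.mk.injEq]
        cases s <;> cases t <;> simp
      clear_value k
      simp only [h2, Equiv.symm_apply_apply]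
      rw [hσv, h1]
      generalize w.idxOf q.1 = i at *
      rcases Nat.lt_or_ge (i + 1) w.length with h | h
      · rw [Nat.mod_eq_of_lt h]
        simp only [Nat.succ_ne_zero, false_or]
        split_ifs <;> first | omega | decide
      · have : i + 1 = w.length := by omega
        rw [this, Nat.mod_self]
        rw [if_pos (by omega), if_neg (by omega), if_pos (Or.inl rfl), add_zero])
  rw [← hmain, ← Equiv.sum_comp (List.Nodup.getEquiv w hw)]
  simp only [List.Nodup.getEquiv_apply_coe, List.get_eq_getElem, hw.idxOf_getElem]
  rw [Fin.sum_univ_eq_sum_range (fun i => if i < k then (1 : ZMod 2) else 0), Finset.sum_boole]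
  congr 1
  rw [show (Finset.range w.length).filter (· < k) = Finset.range k by ext; simp; omega]
  simp

/-! ### Positions of passages in modified words. -/

theorem List.idxOf_eq_of_getElem {l : List Pass} (hl : l.Nodup) {p : Pass} {i : ℕ}
    (hi : i < l.length) (h : l[i] = p) : l.idxOf p = i := by
  rw [← h, hl.idxOf_getElem]

theorem idxOf_reverse_add {w : List Pass} (hw : w.Nodup) {p : Pass} (hp : p ∈ w) :
    w.reverse.idxOf p + w.idxOf p + 1 = w.length := by
  have hi := List.idxOf_lt_length_of_mem hp
  have := List.idxOf_eq_of_getElem (l := w.reverse) (List.nodup_reverse.2 hw) (p := p)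
    (i := w.length - 1 - w.idxOf p) (by simp; omega) (by
      rw [List.getElem_reverse]
      simp only [show w.length - 1 - (w.length - 1 - w.idxOf p) = w.idxOf p by omega]
      exact List.getElem_idxOf hi)
  omega

theorem idxOf_map_of_nodup {w : List Pass} {g : Pass → Pass} (hw : (w.map g).Nodup) {p : Pass}
    (hp : p ∈ w) : (w.map g).idxOf (g p) = w.idxOf p := by
  have hi := List.idxOf_lt_length_of_mem hp
  refine List.idxOf_eq_of_getElem hw (by simpa using hi) ?_
  simp

theorem idxOf_rotate_one {x : Pass} {u : List Pass} (hw : (x :: u).Nodup) {p : Pass}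
    (hp : p ∈ x :: u) :
    (p = x ∧ (x :: u).idxOf p = 0 ∧ (u ++ [x]).idxOf p = u.length) ∨
      (p ≠ x ∧ (x :: u).idxOf p = (u ++ [x]).idxOf p + 1 ∧ (u ++ [x]).idxOf p < u.length) := by
  rw [List.nodup_cons] at hw
  by_cases h : p = x
  · subst h
    simp [List.idxOf_append, hw.1]
  · have hpu : p ∈ u := by simpa [h] using hp
    right
    refine ⟨h, ?_, ?_⟩
    · simp [List.idxOf_append, hpu, Ne.symm h]
    · simpa [List.idxOf_append, hpu] using List.idxOf_lt_length_of_mem hpu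

theorem idxOf_append_cons {u v : List Pass} {p : Pass} (hw : (u ++ p :: v).Nodup) :
    (u ++ p :: v).idxOf p = u.length :=
  List.idxOf_eq_of_getElem hw (by simp) (by simp)

/-- Positions of the passages when two pairs of consecutive passages are inserted. -/
theorem idxOf_insert_pairs {x₁ x₂ y₁ y₂ : Pass} {u v : List Pass}
    (hw : ([x₁, x₂] ++ u ++ [y₁, y₂] ++ v).Nodup) :
    ([x₁, x₂] ++ u ++ [y₁, y₂] ++ v).idxOf x₁ = 0 ∧
    ([x₁, x₂] ++ u ++ [y₁, y₂] ++ v).idxOf x₂ = 1 ∧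
    ([x₁, x₂] ++ u ++ [y₁, y₂] ++ v).idxOf y₁ = u.length + 2 ∧
    ([x₁, x₂] ++ u ++ [y₁, y₂] ++ v).idxOf y₂ = u.length + 3 ∧
    ∀ z, z ≠ x₁ → z ≠ x₂ → z ≠ y₁ → z ≠ y₂ →
      ((u ++ v).idxOf z < u.length ∧
        ([x₁, x₂] ++ u ++ [y₁, y₂] ++ v).idxOf z = (u ++ v).idxOf z + 2) ∨
      (u.length ≤ (u ++ v).idxOf z ∧
        ([x₁, x₂] ++ u ++ [y₁, y₂] ++ v).idxOf z = (u ++ v).idxOf z + 4) := by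
  refine ⟨?_, ?_, ?_, ?_, ?_⟩
  · simp
  · exact List.idxOf_eq_of_getElem hw (by simp) (by simp)
  · simpa using idxOf_append_cons (u := [x₁, x₂] ++ u) (v := y₂ :: v) (by simpa using hw)
  · simpa using idxOf_append_cons (u := [x₁, x₂] ++ u ++ [y₁]) (v := v) (by simpa using hw)
  · intro z h1 h2 h3 h4
    by_cases hz : z ∈ u
    · left
      have := List.idxOf_lt_length_of_mem hz
      simp [List.idxOf_append, hz, h1.symm, h2.symm, this]
    · right
      simp [List.idxOf_append, hz, h1.symm, h2.symm,
        h3.symm, h4.symm]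
      omega

/-- Positions of the passages when three pairs of consecutive passages are marked. -/
theorem idxOf_three_pairs {p₁ p₂ q₁ q₂ r₁ r₂ : Pass} {u v w : List Pass}
    (hw : ([p₁, p₂] ++ u ++ [q₁, q₂] ++ v ++ [r₁, r₂] ++ w).Nodup) :
    ([p₁, p₂] ++ u ++ [q₁, q₂] ++ v ++ [r₁, r₂] ++ w).idxOf p₁ = 0 ∧
    ([p₁, p₂] ++ u ++ [q₁, q₂] ++ v ++ [r₁, r₂] ++ w).idxOf p₂ = 1 ∧
    ([p₁, p₂] ++ u ++ [q₁, q₂] ++ v ++ [r₁, r₂] ++ w).idxOf q₁ = u.length + 2 ∧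
    ([p₁, p₂] ++ u ++ [q₁, q₂] ++ v ++ [r₁, r₂] ++ w).idxOf q₂ = u.length + 3 ∧
    ([p₁, p₂] ++ u ++ [q₁, q₂] ++ v ++ [r₁, r₂] ++ w).idxOf r₁ = u.length + v.length + 4 ∧
    ([p₁, p₂] ++ u ++ [q₁, q₂] ++ v ++ [r₁, r₂] ++ w).idxOf r₂ = u.length + v.length + 5 := by
  refine ⟨?_, ?_, ?_, ?_, ?_, ?_⟩
  · simp
  · exact List.idxOf_eq_of_getElem hw (by simp) (by simp)
  · simpa [add_assoc, add_comm, add_left_comm] using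
      idxOf_append_cons (u := [p₁, p₂] ++ u) (v := q₂ :: v ++ [r₁, r₂] ++ w) (by simpa using hw)
  · simpa [add_assoc, add_comm, add_left_comm] using
      idxOf_append_cons (u := [p₁, p₂] ++ u ++ [q₁]) (v := v ++ [r₁, r₂] ++ w) (by simpa using hw)
  · simpa [add_assoc, add_comm, add_left_comm] using
      idxOf_append_cons (u := [p₁, p₂] ++ u ++ [q₁, q₂] ++ v) (v := r₂ :: w) (by simpa using hw)
  · simpa [add_assoc, add_comm, add_left_comm] using
      idxOf_append_cons (u := [p₁, p₂] ++ u ++ [q₁, q₂] ++ v ++ [r₁]) (v := w) (by simpa using hw)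

theorem idxOf_swap_three_pairs {p₁ p₂ q₁ q₂ r₁ r₂ : Pass} {u v w : List Pass} {z : Pass}
    (h1 : z ≠ p₁) (h2 : z ≠ p₂) (h3 : z ≠ q₁) (h4 : z ≠ q₂) (h5 : z ≠ r₁) (h6 : z ≠ r₂) :
    ([p₁, p₂] ++ u ++ [q₁, q₂] ++ v ++ [r₁, r₂] ++ w).idxOf z =
      ([p₂, p₁] ++ u ++ [q₂, q₁] ++ v ++ [r₂, r₁] ++ w).idxOf z := by
  simp [List.idxOf_append, h1.symm, h2.symm,
        h3.symm, h4.symm, h5.symm, h6.symm]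

/-- Turns the subwords in `ChordsIntersect` into inequalities between positions, to which `omega`
applies. -/
theorem sublist_iff_idxOf {w : List Pass} (hw : w.Nodup) (l : List Pass) :
    l.Sublist w ↔ l ⊆ w ∧ l.Pairwise (fun p q => w.idxOf p < w.idxOf q) := by
  have hs : w.Pairwise (fun p q => w.idxOf p < w.idxOf q) := by
    rw [List.pairwise_iff_getElem]
    intro i j hi hj hij
    rwa [hw.idxOf_getElem, hw.idxOf_getElem]
  constructor
  · intro h
    exact ⟨h.subset, hs.sublist h⟩
  · rintro ⟨h1, h2⟩
    have : Std.Antisymm (fun p q : Pass => w.idxOf p < w.idxOf q) :=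
      ⟨fun _ _ hab hba => absurd hab (by omega)⟩
    refine List.sublist_of_subperm_of_pairwise (List.subperm_of_subset ?_ h1) h2 hs
    exact h2.imp fun {a b} h => by rintro rfl; omega

/-! ### Alternating chords and the Arf sum, for abstract positions. -/

/-- The ends of the chords `c` and `d` alternate, for passages in the order of `f`. -/
def Interleaved (f : Pass → ℕ) (c d : ℕ) : Prop :=
  ∃ s t : Bool, (f (c, s) < f (d, t) ∧ f (d, t) < f (c, !s) ∧ f (c, !s) < f (d, !t)) ∨
    (f (d, t) < f (c, s) ∧ f (c, s) < f (d, !t) ∧ f (d, !t) < f (c, !s))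

/-- The passages of `c` and `d` come in the order `c` under, `d` over, `c` over, `d` under, where
`(c, t c)` is the upper passage through `c`. -/
abbrev ArfPair (f : Pass → ℕ) (t : ℕ → Bool) (c d : ℕ) : Prop :=
  f (c, !t c) < f (d, t d) ∧ f (d, t d) < f (c, t c) ∧ f (c, t c) < f (d, !t d)

/-- The Arf invariant of a based Gauss diagram with crossings `V`, positions `f` and upper
passages `t`. -/
def arfSum (f : Pass → ℕ) (t : ℕ → Bool) (V : Finset ℕ) : ZMod 2 :=
  ∑ c ∈ V, ∑ d ∈ V, if ArfPair f t c d then 1 else 0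

/-- The passages of `c` and `d` are in the same order for `f` as those of `c'` and `d'` for `g`,
where the passages of `c` and `c'` correspond to each other with a flip if `σ` holds. -/
def SameOrder (f g : Pass → ℕ) (c d c' d' : ℕ) (σ : Bool) : Prop :=
  ∀ s t, (f (c, s) < f (d, t) ↔ g (c', xor σ s) < g (d', t)) ∧
    (f (d, t) < f (c, s) ↔ g (d', t) < g (c', xor σ s))

theorem Interleaved.symm {f : Pass → ℕ} {c d : ℕ} (h : Interleaved f c d) :
    Interleaved f d c := by
  obtain ⟨s, t, h⟩ := h
  exact ⟨t, s, h.symm⟩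

theorem interleaved_comm {f : Pass → ℕ} {c d : ℕ} : Interleaved f c d ↔ Interleaved f d c :=
  ⟨Interleaved.symm, Interleaved.symm⟩

theorem Interleaved.ne {f : Pass → ℕ} {c d : ℕ} (h : Interleaved f c d) : c ≠ d := by
  rintro rfl
  obtain ⟨s, t, h⟩ := h
  cases s <;> cases t <;> simp only [Bool.not_true, Bool.not_false] at h <;> omega

theorem not_arfPair_self (f : Pass → ℕ) (t : ℕ → Bool) (c : ℕ) : ¬ ArfPair f t c c := by
  rintro ⟨-, h, -⟩
  omega

theorem SameOrder.interleaved_imp {f g : Pass → ℕ} {c d c' d' : ℕ} {σ : Bool}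
    (h : SameOrder f g c d c' d' σ) (hi : Interleaved f c d) : Interleaved g c' d' := by
  obtain ⟨s, t, hi⟩ := hi
  refine ⟨xor σ s, t, ?_⟩
  rw [← Bool.xor_not, ← (h s t).1, ← (h s t).2, ← (h s (!t)).1, ← (h (!s) t).2,
    ← (h (!s) (!t)).1, ← (h (!s) (!t)).2]
  exact hi

theorem SameOrder.symm {f g : Pass → ℕ} {c d c' d' : ℕ} {σ : Bool}
    (h : SameOrder f g c d c' d' σ) : SameOrder g f c' d' c d σ := by
  intro s t
  have := h (xor σ s) t
  rw [← Bool.xor_assoc, Bool.xor_self, Bool.false_xor] at this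
  exact ⟨this.1.symm, this.2.symm⟩

theorem SameOrder.interleaved_iff {f g : Pass → ℕ} {c d c' d' : ℕ} {σ : Bool}
    (h : SameOrder f g c d c' d' σ) : Interleaved f c d ↔ Interleaved g c' d' :=
  ⟨h.interleaved_imp, h.symm.interleaved_imp⟩

theorem SameOrder.arfPair_iff {f g : Pass → ℕ} {c d c' d' : ℕ} {σ : Bool} {t t' : ℕ → Bool}
    (h : SameOrder f g c d c' d' σ) (hc : t' c' = xor σ (t c)) (hd : t' d' = t d) :
    (ArfPair f t c d ↔ ArfPair g t' c' d') ∧ (ArfPair f t d c ↔ ArfPair g t' d' c') := by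
  simp only [ArfPair, hc, hd, ← Bool.xor_not, (h _ _).1, (h _ _).2, and_self]

theorem sum_ite_idxOf_lt {w : List Pass} (hw : w.Nodup) {k : ℕ} (hk : k ≤ w.length) :
    ∑ p ∈ w.toFinset, (if w.idxOf p < k then (1 : ZMod 2) else 0) = k := by
  rw [Finset.sum_boole]
  congr 1
  have h : w.toFinset.filter (fun p => w.idxOf p < k) = (w.take k).toFinset := by
    ext p
    simp only [Finset.mem_filter, List.mem_toFinset]
    constructor
    · rintro ⟨hp, hlt⟩
      exact (List.mem_take_iff_idxOf_lt hp).2 hlt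
    · intro h
      exact ⟨List.mem_of_mem_take h, (List.mem_take_iff_idxOf_lt (List.mem_of_mem_take h)).1 h⟩
  rw [h, List.toFinset_card_of_nodup (hw.sublist (List.take_sublist _ _))]
  simpa using hk

theorem arfSum_insert (f : Pass → ℕ) (t : ℕ → Bool) {V : Finset ℕ} {c : ℕ} (hc : c ∉ V) :
    arfSum f t (insert c V) = arfSum f t V +
      ∑ d ∈ V, ((if ArfPair f t c d then 1 else 0) + if ArfPair f t d c then 1 else 0) := by
  simp only [arfSum, Finset.sum_insert hc, if_neg (not_arfPair_self f t c), zero_add,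
    Finset.sum_add_distrib]
  ring

theorem arfSum_congr {f g : Pass → ℕ} {t t' : ℕ → Bool} {V : Finset ℕ}
    (h : ∀ c ∈ V, ∀ d ∈ V, c ≠ d → (ArfPair f t c d ↔ ArfPair g t' c d)) :
    arfSum f t V = arfSum g t' V := by
  refine Finset.sum_congr rfl fun c hc => Finset.sum_congr rfl fun d hd => ?_
  by_cases hcd : c = d
  · subst hcd
    rw [if_neg (not_arfPair_self f t c), if_neg (not_arfPair_self g t' c)]
  · simp only [h c hc d hd hcd]

theorem arfSum_image {f g : Pass → ℕ} {t t' : ℕ → Bool} {V : Finset ℕ} {m : ℕ → ℕ}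
    (hm : Set.InjOn m V)
    (h : ∀ c ∈ V, ∀ d ∈ V, (ArfPair f t c d ↔ ArfPair g t' (m c) (m d))) :
    arfSum g t' (V.image m) = arfSum f t V := by
  rw [arfSum, Finset.sum_image hm]
  refine Finset.sum_congr rfl fun c hc => ?_
  rw [Finset.sum_image hm]
  exact Finset.sum_congr rfl fun d hd => by simp only [h c hc d hd]

/-! ### Positions, crossings and the Arf invariant of a pseudodiagram. -/

namespace Pseudodiagram

/-- The position of a passage in the Gauss diagram. -/
def pos (D : Pseudodiagram) (p : Pass) : ℕ := D.word.idxOf p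

/-- The double points of a pseudodiagram. -/
def crossings (D : Pseudodiagram) : Finset ℕ := (D.word.map Prod.fst).toFinset

theorem mem_crossings_of_mem {D : Pseudodiagram} {p : Pass} (h : p ∈ D.word) :
    p.1 ∈ D.crossings :=
  List.mem_toFinset.2 (List.mem_map_of_mem h)

theorem mem_word {D : Pseudodiagram} {c : ℕ} (h : c ∈ D.crossings) (s : Bool) :
    (c, s) ∈ D.word := by
  simp only [crossings, List.mem_toFinset, List.mem_map] at h
  obtain ⟨⟨c', s'⟩, h, rfl⟩ := h
  rcases Bool.eq_or_eq_not s s' with e | e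
  · rwa [e]
  · rw [e]; exact D.passedTwice _ _ h

theorem mem_crossings {D : Pseudodiagram} {c : ℕ} (s : Bool) :
    c ∈ D.crossings ↔ (c, s) ∈ D.word :=
  ⟨fun h => mem_word h s, fun h => mem_crossings_of_mem h⟩

theorem crossings_congr {D D' : Pseudodiagram} (h : ∀ p, p ∈ D'.word ↔ p ∈ D.word) :
    D'.crossings = D.crossings := by
  ext c
  rw [mem_crossings true, mem_crossings true, h]

theorem pos_inj {D : Pseudodiagram} {p q : Pass} (hp : p ∈ D.word) (h : D.pos p = D.pos q) :
    p = q :=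
  (List.idxOf_inj hp).1 h

theorem pos_ne {D : Pseudodiagram} {c d : ℕ} (hc : c ∈ D.crossings) (hcd : c ≠ d) (s t : Bool) :
    D.pos (c, s) ≠ D.pos (d, t) := fun h =>
  hcd (congrArg Prod.fst (pos_inj (mem_word hc s) h))

theorem chordsIntersect_iff {D : Pseudodiagram} {c d : ℕ} :
    D.ChordsIntersect c d ↔ c ∈ D.crossings ∧ d ∈ D.crossings ∧ Interleaved D.pos c d := by
  simp only [ChordsIntersect, sublist_iff_idxOf D.nodup]
  constructor
  · rintro ⟨s, t, h⟩
    have hc : (c, s) ∈ D.word := by rcases h with h | h <;> exact h.1 (by simp)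
    have hd : (d, t) ∈ D.word := by rcases h with h | h <;> exact h.1 (by simp)
    refine ⟨mem_crossings_of_mem hc, mem_crossings_of_mem hd, s, t, ?_⟩
    simp only [pos]
    rcases h with ⟨-, h⟩ | ⟨-, h⟩ <;> simp at h <;> omega
  · rintro ⟨hc, hd, s, t, h⟩
    have hc' := fun s => mem_word hc s
    have hd' := fun s => mem_word hd s
    refine ⟨s, t, ?_⟩
    simp only [pos] at h
    rcases h with h | h
    · left
      simp [hc', hd']
      omega
    · right
      simp [hc', hd']
      omega

theorem hasIntersectingPrechords_iff {D : Pseudodiagram} :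
    D.HasIntersectingPrechords ↔ ∃ c ∈ D.crossings, ∃ d ∈ D.crossings,
      D.info c = none ∧ D.info d = none ∧ Interleaved D.pos c d := by
  simp only [HasIntersectingPrechords, IsPrecrossing, chordsIntersect_iff, ← mem_crossings]
  constructor
  · rintro ⟨c, d, ⟨hc, ic⟩, ⟨hd, id⟩, -, -, h⟩
    exact ⟨c, hc, d, hd, ic, id, h⟩
  · rintro ⟨c, hc, d, hd, ic, id, h⟩
    exact ⟨c, d, ⟨hc, ic⟩, ⟨hd, id⟩, hc, hd, h⟩

/-- The upper passage through each double point, where precrossings are resolved positively. -/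
def top (D : Pseudodiagram) (c : ℕ) : Bool := (D.info c).getD true

/-- The Arf invariant, computed from the Gauss diagram. -/
def arf (D : Pseudodiagram) : ZMod 2 := arfSum D.pos D.top D.crossings

/-- Rotation of the starting point by `n` passages. -/
def rotate (D : Pseudodiagram) (n : ℕ) : Pseudodiagram where
  word := D.word.rotate n
  info := D.info
  nodup := List.nodup_rotate.2 D.nodup
  passedTwice c s h := by
    rw [List.mem_rotate] at h ⊢
    exact D.passedTwice c s h
  spherical := by
    have h := D.spherical
    have hf : facePerm (D.word.rotate n) = facePerm D.word := by
      have : edgePerm (D.word.rotate n) = edgePerm D.word := by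
        ext1 d
        simp only [edgePerm, List.formPerm_rotate _ D.nodup]
      rw [facePerm, facePerm, this]
    simpa [IsSpherical, faces, hf] using h

/-- Reduces a rotation to moving one passage from the front to the back. The type `α` is arbitrary
so that both a proposition and the Arf invariant can be transported. -/
theorem eq_of_isRotated {α : Type*} (X : Pseudodiagram → α)
    (hX : ∀ (D D' : Pseudodiagram) (x : Pass) (u : List Pass), D.word = x :: u →
      D'.word = u ++ [x] → D'.info = D.info → X D' = X D)
    {D D' : Pseudodiagram} (hw : D'.word ~r D.word) (hi : D'.info = D.info) : X D' = X D := by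
  have step : ∀ n, X (D.rotate n) = X D := by
    intro n
    induction n with
    | zero =>
      congr 1
      cases D
      simp [rotate]
    | succ n ih =>
      rw [← ih]
      cases h : D.word.rotate n with
      | nil =>
        congr 1
        have h0 : D.word = [] := by simpa using h
        simp [rotate, h0]
      | cons x u =>
        refine hX (D.rotate n) (D.rotate (n + 1)) x u h ?_ rfl
        change D.word.rotate (n + 1) = _
        rw [← List.rotate_rotate, h]
        simp
  obtain ⟨n, hn⟩ := hw.symm
  rw [← step n]
  congr 1
  cases D
  cases D'
  simp only at hn hi
  subst hn hi
  rfl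

end Pseudodiagram

/-! ### Change of starting point, direction and names. -/

theorem Interleaved.of_reverse {f g : Pass → ℕ} {c d : ℕ} {n : ℕ}
    (hc : ∀ s, g (c, s) + f (c, s) + 1 = n) (hd : ∀ s, g (d, s) + f (d, s) + 1 = n)
    (h : Interleaved f c d) : Interleaved g c d := by
  obtain ⟨s, t, h⟩ := h
  refine ⟨!s, !t, ?_⟩
  have h1 := hc s
  have h2 := hc (!s)
  have h3 := hd t
  have h4 := hd (!t)
  simp only [Bool.not_not]
  omega

theorem interleaved_iff_of_reverse {f g : Pass → ℕ} {c d : ℕ} {n : ℕ}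
    (hc : ∀ s, g (c, s) + f (c, s) + 1 = n) (hd : ∀ s, g (d, s) + f (d, s) + 1 = n) :
    Interleaved g c d ↔ Interleaved f c d :=
  ⟨.of_reverse (n := n) (fun s => by rw [← hc s, add_comm (f _)])
      fun s => by rw [← hd s, add_comm (f _)],
    .of_reverse hc hd⟩

theorem interleaved_iff_of_rotate {f g : Pass → ℕ} {c d : ℕ} {n : ℕ}
    (hc : ∀ s, (f (c, s) = 0 ∧ g (c, s) = n) ∨ (f (c, s) = g (c, s) + 1 ∧ g (c, s) < n))
    (hd : ∀ s, (f (d, s) = 0 ∧ g (d, s) = n) ∨ (f (d, s) = g (d, s) + 1 ∧ g (d, s) < n)) :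
    Interleaved g c d ↔ Interleaved f c d := by
  constructor
  · rintro ⟨s, t, h⟩
    have h1 := hc s
    have h2 := hc (!s)
    have h3 := hd t
    have h4 := hd (!t)
    -- Only the last of the four ends for `g` can be the first for `f`. If it is, the cyclic order
    -- is read from that end, which flips the choice of first end on its chord.
    by_cases hx : f (d, !t) = 0
    · refine ⟨s, !t, ?_⟩
      simp only [Bool.not_not]
      omega
    by_cases hy : f (c, !s) = 0
    · refine ⟨!s, t, ?_⟩
      simp only [Bool.not_not]
      omega
    · refine ⟨s, t, ?_⟩
      omega
  · rintro ⟨s, t, h⟩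
    have h1 := hc s
    have h2 := hc (!s)
    have h3 := hd t
    have h4 := hd (!t)
    by_cases hx : f (d, t) = 0
    · refine ⟨s, !t, ?_⟩
      simp only [Bool.not_not]
      omega
    by_cases hy : f (c, s) = 0
    · refine ⟨!s, t, ?_⟩
      simp only [Bool.not_not]
      omega
    · refine ⟨s, t, ?_⟩
      omega

/-- The pattern under, over, over, under is a palindrome; reversal exchanges the roles of the two
chords. -/
theorem arfPair_iff_of_reverse {f g : Pass → ℕ} (t : ℕ → Bool) {c d : ℕ} {n : ℕ}
    (hc : ∀ s, g (c, s) + f (c, s) + 1 = n) (hd : ∀ s, g (d, s) + f (d, s) + 1 = n) :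
    ArfPair g t c d ↔ ArfPair f t d c := by
  have h1 := hc (t c)
  have h2 := hc (!t c)
  have h3 := hd (t d)
  have h4 := hd (!t d)
  simp only [ArfPair]
  omega

namespace Pseudodiagram

variable {D D' : Pseudodiagram}

theorem HasIntersectingPrechords.congr (hV : D'.crossings = D.crossings) (hi : D'.info = D.info)
    (h : ∀ c ∈ D.crossings, ∀ d ∈ D.crossings, c ≠ d → D.info c = none → D.info d = none →
      (Interleaved D'.pos c d ↔ Interleaved D.pos c d)) :
    D'.HasIntersectingPrechords ↔ D.HasIntersectingPrechords := by
  simp only [hasIntersectingPrechords_iff, hV, hi]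
  constructor
  · rintro ⟨c, hc, d, hd, ic, id, H⟩
    exact ⟨c, hc, d, hd, ic, id, (h c hc d hd H.ne ic id).1 H⟩
  · rintro ⟨c, hc, d, hd, ic, id, H⟩
    exact ⟨c, hc, d, hd, ic, id, (h c hc d hd H.ne ic id).2 H⟩

theorem top_congr (hi : D'.info = D.info) : D'.top = D.top := by
  funext c
  rw [top, top, hi]

section Rotation

variable {c : ℕ} {s : Bool} {u : List Pass}

theorem pos_rotate_one (hw : D.word = (c, s) :: u) (hw' : D'.word = u ++ [(c, s)]) {d : ℕ}
    (hd : d ∈ D.crossings) (t : Bool) :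
    ((d, t) = (c, s) ∧ D.pos (d, t) = 0 ∧ D'.pos (d, t) = u.length) ∨
      ((d, t) ≠ (c, s) ∧ D.pos (d, t) = D'.pos (d, t) + 1 ∧ D'.pos (d, t) < u.length) := by
  have hn := D.nodup
  have hm := mem_word hd t
  rw [hw] at hn hm
  simp only [pos, hw, hw']
  exact idxOf_rotate_one hn hm

theorem crossings_rotate_one {x : Pass} (hw : D.word = x :: u) (hw' : D'.word = u ++ [x]) :
    D'.crossings = D.crossings :=
  crossings_congr fun p => by simp [hw, hw', or_comm]

theorem interleaved_rotate_one (hw : D.word = (c, s) :: u) (hw' : D'.word = u ++ [(c, s)])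
    {d e : ℕ} (hd : d ∈ D.crossings) (he : e ∈ D.crossings) :
    Interleaved D'.pos d e ↔ Interleaved D.pos d e :=
  interleaved_iff_of_rotate (fun t => (pos_rotate_one hw hw' hd t).imp And.right And.right)
    fun t => (pos_rotate_one hw hw' he t).imp And.right And.right

theorem hasIntersectingPrechords_isRotated (hw : D'.word ~r D.word) (hi : D'.info = D.info) :
    D'.HasIntersectingPrechords ↔ D.HasIntersectingPrechords := by
  refine iff_of_eq (eq_of_isRotated _ ?_ hw hi)
  rintro D D' ⟨c, s⟩ u hw hw' hi
  refine propext (HasIntersectingPrechords.congr (crossings_rotate_one hw hw') hi ?_)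
  intro d hd e he _ _ _
  exact interleaved_rotate_one hw hw' hd he

theorem toFinset_word (D : Pseudodiagram) : D.word.toFinset = D.crossings ×ˢ Finset.univ := by
  ext ⟨c, s⟩
  simp [mem_crossings s]

theorem arf_rotate_one (hw : D.word = (c, s) :: u) (hw' : D'.word = u ++ [(c, s)])
    (hi : D'.info = D.info) : D'.arf = D.arf := by
  have hcV : c ∈ D.crossings := (mem_crossings s).2 (by simp [hw])
  obtain ⟨V, hcV', hV⟩ : ∃ V, c ∉ V ∧ D.crossings = insert c V :=
    ⟨D.crossings.erase c, by simp, (Finset.insert_erase hcV).symm⟩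
  have hVD : ∀ d ∈ V, d ∈ D.crossings ∧ d ≠ c := fun d hd =>
    ⟨by rw [hV]; exact Finset.mem_insert_of_mem hd, fun h => hcV' (h ▸ hd)⟩
  rw [arf, arf, crossings_rotate_one hw hw', top_congr hi, hV, arfSum_insert _ _ hcV',
    arfSum_insert _ _ hcV']
  have h0 : D.pos (c, s) = 0 := by simp [pos, hw]
  have hpc : D.pos (c, !s) = D'.pos (c, !s) + 1 ∧ D'.pos (c, !s) < u.length := by
    have := pos_rotate_one hw hw' hcV (!s)
    simpa using this
  have h0' : D'.pos (c, s) = u.length := by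
    have := pos_rotate_one hw hw' hcV s
    simp only [ne_eq, not_true_eq_false, true_and, false_and, or_false] at this
    exact this.2
  have hpd : ∀ d ∈ V, ∀ t, D.pos (d, t) = D'.pos (d, t) + 1 ∧ D'.pos (d, t) < u.length := by
    intro d hd t
    have := pos_rotate_one hw hw' (hVD d hd).1 t
    simpa [(hVD d hd).2] using this
  congr 1
  · refine arfSum_congr fun d hd e he hde => ?_
    have h1 := hpd d hd
    have h2 := hpd e he
    simp only [ArfPair, (h1 _).1, (h2 _).1]
    omega
  -- The pattern never begins or ends with an upper passage, so an upper `(c, s)` contributes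
  -- nothing before or after the move.
  · rcases Bool.eq_or_eq_not (D.top c) s with ht | ht
    · refine Finset.sum_congr rfl fun d hd => ?_
      have h1 := hpd d hd (D.top d)
      have h2 := hpd d hd (!D.top d)
      simp only [ArfPair, ht]
      rw [if_neg (by omega), if_neg (by omega), if_neg (by omega), if_neg (by omega)]
    -- For a lower `(c, s)`, a chord `d` counts before the move if only its upper passage precedes
    -- `(c, !s)`, and after the move if only its lower one does. The difference is the number of
    -- chords that intersect `c`, which has the parity of the number of passages strictly between
    -- the ends of `c`.
    · have hk : ((D.pos (c, !s) : ℕ) : ZMod 2) = 1 := by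
        have h1 := D.nodup
        have h2 := D.passedTwice
        have h3 := D.spherical
        rw [hw] at h1 h2 h3
        rw [pos, hw]
        exact odd_idxOf_of_isSpherical h1 h2 h3
      set k := D.pos (c, !s) with hkdef
      have hklen : k ≤ D.word.length := List.idxOf_le_length
      have hsum := sum_ite_idxOf_lt D.nodup hklen
      rw [hk, toFinset_word, hV, Finset.sum_product, Finset.sum_insert hcV', Fintype.sum_bool] at hsum
      have hcsum : (if D.word.idxOf (c, true) < k then (1 : ZMod 2) else 0) +
          (if D.word.idxOf (c, false) < k then (1 : ZMod 2) else 0) = 1 := by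
        change (if D.pos (c, true) < k then (1 : ZMod 2) else 0) +
          (if D.pos (c, false) < k then (1 : ZMod 2) else 0) = 1
        cases s <;> simp only [Bool.not_true, Bool.not_false] at hkdef h0 hpc
        · rw [← hkdef, if_neg (lt_irrefl _), if_pos (by omega), zero_add]
        · rw [← hkdef, if_neg (lt_irrefl _), if_pos (by omega), add_zero]
      rw [hcsum, add_eq_left] at hsum
      rw [← sub_eq_zero, ← Finset.sum_sub_distrib]
      refine Eq.trans ?_ hsum
      refine Finset.sum_congr rfl fun d hd => ?_
      rw [Fintype.sum_bool]
      change _ = (if D.pos (d, true) < k then (1 : ZMod 2) else 0) +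
        (if D.pos (d, false) < k then (1 : ZMod 2) else 0)
      have h1 := hpd d hd true
      have h2 := hpd d hd false
      have h3 := pos_ne hcV (hVD d hd).2.symm (!s) true
      have h4 := pos_ne hcV (hVD d hd).2.symm (!s) false
      rw [← hkdef] at h3 h4
      simp only [ArfPair, ht, Bool.not_not]
      rw [if_neg (show ¬ (D'.pos (c, s) < _ ∧ _ ∧ _) by have := hpd d hd (D.top d); omega),
        if_neg (show ¬ (D.pos (d, !D.top d) < D.pos (c, !s) ∧ _ ∧ D.pos (d, D.top d) < D.pos (c, s))
          by omega)]
      rw [← hkdef, h0, h0']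
      cases D.top d <;> simp only [Bool.not_true, Bool.not_false] <;>
        rcases lt_or_gt_of_ne h3 with h3 | h3 <;> rcases lt_or_gt_of_ne h4 with h4 | h4 <;>
        (repeat' first | rw [if_pos (by omega)] | rw [if_neg (by omega)]) <;> decide

theorem arf_isRotated (hw : D'.word ~r D.word) (hi : D'.info = D.info) : D'.arf = D.arf := by
  refine eq_of_isRotated _ ?_ hw hi
  rintro D D' ⟨c, s⟩ u hw hw' hi
  exact arf_rotate_one hw hw' hi

end Rotation

section Reverse

theorem pos_reverse (hw : D'.word = D.word.reverse) {c : ℕ} (hc : c ∈ D.crossings) (s : Bool) :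
    D'.pos (c, s) + D.pos (c, s) + 1 = D.word.length := by
  rw [pos, pos, hw]
  exact idxOf_reverse_add D.nodup (mem_word hc s)

theorem crossings_reverse (hw : D'.word = D.word.reverse) : D'.crossings = D.crossings :=
  crossings_congr fun p => by simp [hw]

theorem hasIntersectingPrechords_reverse (hw : D'.word = D.word.reverse) (hi : D'.info = D.info) :
    D'.HasIntersectingPrechords ↔ D.HasIntersectingPrechords :=
  HasIntersectingPrechords.congr (crossings_reverse hw) hi fun _ hc _ hd _ _ _ =>
    interleaved_iff_of_reverse (pos_reverse hw hc) (pos_reverse hw hd)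

theorem arf_reverse (hw : D'.word = D.word.reverse) (hi : D'.info = D.info) :
    D'.arf = D.arf := by
  rw [arf, arf, crossings_reverse hw, top_congr hi, arfSum, Finset.sum_comm]
  refine Finset.sum_congr rfl fun c hc => Finset.sum_congr rfl fun d hd => ?_
  simp only [arfPair_iff_of_reverse D.top (pos_reverse hw hd) (pos_reverse hw hc)]

end Reverse

section Rename

variable {m : ℕ → ℕ}

theorem sameOrder_rename (hw : D'.word = D.word.map fun p => (m p.1, p.2)) {c d : ℕ}
    (hc : c ∈ D.crossings) (hd : d ∈ D.crossings) :
    SameOrder D.pos D'.pos c d (m c) (m d) false := by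
  have key : ∀ c ∈ D.crossings, ∀ s, D'.pos (m c, s) = D.pos (c, s) := by
    intro c hc s
    have hn := D'.nodup
    rw [hw] at hn
    rw [pos, pos, hw]
    exact idxOf_map_of_nodup hn (mem_word hc s)
  intro s t
  simp [key c hc, key d hd]

theorem crossings_rename (hw : D'.word = D.word.map fun p => (m p.1, p.2)) :
    D'.crossings = D.crossings.image m := by
  ext c
  simp only [crossings, hw, List.mem_toFinset, Finset.mem_image, List.mem_map]
  constructor
  · rintro ⟨_, ⟨p, hp, rfl⟩, rfl⟩
    exact ⟨p.1, ⟨p, hp, rfl⟩, rfl⟩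
  · rintro ⟨_, ⟨p, hp, rfl⟩, rfl⟩
    exact ⟨_, ⟨p, hp, rfl⟩, rfl⟩

theorem injOn_rename (hw : D'.word = D.word.map fun p => (m p.1, p.2)) :
    Set.InjOn m D.crossings := by
  intro c hc d hd h
  have hn := D'.nodup
  rw [hw] at hn
  have := List.inj_on_of_nodup_map hn (mem_word hc true) (mem_word hd true) (by simp [h])
  exact congrArg Prod.fst this

theorem hasIntersectingPrechords_rename (hw : D'.word = D.word.map fun p => (m p.1, p.2))
    (hi : ∀ p ∈ D.word, D'.info (m p.1) = D.info p.1) :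
    D'.HasIntersectingPrechords ↔ D.HasIntersectingPrechords := by
  have hi' : ∀ c ∈ D.crossings, D'.info (m c) = D.info c := fun c hc => hi _ (mem_word hc true)
  simp only [hasIntersectingPrechords_iff, crossings_rename hw, Finset.exists_mem_image]
  constructor
  · rintro ⟨c, hc, d, hd, ic, id, H⟩
    exact ⟨c, hc, d, hd, hi' c hc ▸ ic, hi' d hd ▸ id, (sameOrder_rename hw hc hd).interleaved_iff.2 H⟩
  · rintro ⟨c, hc, d, hd, ic, id, H⟩
    exact ⟨c, hc, d, hd, (hi' c hc).trans ic, (hi' d hd).trans id,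
      (sameOrder_rename hw hc hd).interleaved_iff.1 H⟩

theorem arf_rename (hw : D'.word = D.word.map fun p => (m p.1, p.2))
    (hi : ∀ p ∈ D.word, D'.info (m p.1) = D.info p.1) : D'.arf = D.arf := by
  have ht : ∀ c ∈ D.crossings, D'.top (m c) = D.top c := fun c hc => by
    rw [top, top, hi _ (mem_word hc true)]
  rw [arf, arf, crossings_rename hw]
  refine arfSum_image (injOn_rename hw) fun c hc d hd => ?_
  exact ((sameOrder_rename hw hc hd).arfPair_iff (by simp [ht c hc]) (ht d hd)).1

end Rename

/-! ### The moves R1 and PR1. -/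

section Loop

variable {c : ℕ} {s : Bool}

theorem notMem_crossings_loop (hw : D'.word = [(c, s), (c, !s)] ++ D.word) :
    c ∉ D.crossings := by
  intro hc
  have hn := D'.nodup
  rw [hw] at hn
  simp [mem_word hc s] at hn

theorem crossings_loop (hw : D'.word = [(c, s), (c, !s)] ++ D.word) :
    D'.crossings = insert c D.crossings := by
  simp [crossings, hw]

theorem pos_loop (hw : D'.word = [(c, s), (c, !s)] ++ D.word) {d : ℕ} (hd : d ∈ D.crossings)
    (t : Bool) : D'.pos (d, t) = D.pos (d, t) + 2 := by
  have hdc : c ≠ d := fun h => notMem_crossings_loop hw (h ▸ hd)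
  simp [pos, hw, hdc]

theorem pos_loop_self (hw : D'.word = [(c, s), (c, !s)] ++ D.word) (t : Bool) :
    D'.pos (c, t) < 2 := by
  cases s <;> cases t <;> simp [pos, hw]

theorem hasIntersectingPrechords_loop (hw : D'.word = [(c, s), (c, !s)] ++ D.word)
    (hi : D'.info = D.info) : D'.HasIntersectingPrechords ↔ D.HasIntersectingPrechords := by
  have hc : ∀ d ∈ D.crossings, ¬ Interleaved D'.pos c d := by
    rintro d hd ⟨s, t, h⟩
    have h1 := pos_loop hw hd t
    have h2 := pos_loop hw hd (!t)
    have h3 := pos_loop_self hw s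
    have h4 := pos_loop_self hw (!s)
    omega
  have hd : ∀ d ∈ D.crossings, ∀ e ∈ D.crossings, SameOrder D.pos D'.pos d e d e false := by
    intro d hd e he s t
    simp [pos_loop hw hd, pos_loop hw he]
  simp only [hasIntersectingPrechords_iff, hi]
  constructor
  · rintro ⟨d, hd1, e, he, id, ie, H⟩
    rw [crossings_loop hw, Finset.mem_insert] at hd1 he
    rcases hd1 with rfl | hd1
    · rcases he with rfl | he
      · exact absurd rfl H.ne
      · exact absurd H (hc e he)
    · rcases he with rfl | he
      · exact absurd H.symm (hc d hd1)
      · exact ⟨d, hd1, e, he, id, ie, (hd d hd1 e he).interleaved_iff.2 H⟩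
  · rintro ⟨d, hd1, e, he, id, ie, H⟩
    rw [crossings_loop hw]
    exact ⟨d, Finset.mem_insert_of_mem hd1, e, Finset.mem_insert_of_mem he, id, ie,
      (hd d hd1 e he).interleaved_iff.1 H⟩

theorem arf_loop (hw : D'.word = [(c, s), (c, !s)] ++ D.word) (hi : D'.info = D.info) :
    D'.arf = D.arf := by
  rw [arf, arf, crossings_loop hw, top_congr hi, arfSum_insert _ _ (notMem_crossings_loop hw),
    Finset.sum_eq_zero, add_zero]
  · refine arfSum_congr fun d hd e he _ => ?_
    simp only [ArfPair, pos_loop hw hd, pos_loop hw he, add_lt_add_iff_right]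
  · intro d hd
    have h1 := pos_loop hw hd (D.top d)
    have h2 := pos_loop hw hd (!D.top d)
    have h3 := pos_loop_self hw (D.top c)
    have h4 := pos_loop_self hw (!D.top c)
    rw [if_neg (by simp only [ArfPair]; omega), if_neg (by simp only [ArfPair]; omega), add_zero]

end Loop

end Pseudodiagram

theorem zmod_two_add_self (a : ZMod 2) : a + a = 0 := by
  revert a; decide

namespace Pseudodiagram

variable {D D' : Pseudodiagram}

/-! ### The moves R2 and PR2. -/

section Bigon

variable {a b : ℕ} {p q u v : List Pass}

theorem bigon_mem (h : Bigon a b p q) (hw : D.word = p ++ u ++ q ++ v) :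
    a ∈ D.crossings ∧ b ∈ D.crossings := by
  obtain ⟨s, rfl, -⟩ := h
  exact ⟨(mem_crossings s).2 (by simp [hw]), (mem_crossings (!s)).2 (by simp [hw])⟩

theorem bigon_ne (h : Bigon a b p q) (hw : D.word = p ++ u ++ q ++ v) : a ≠ b := by
  rintro rfl
  have hn := D.nodup
  rw [hw] at hn
  obtain ⟨s, rfl, rfl | rfl⟩ := h <;> simp at hn

/-- The strands of a bigon pass its two corners consecutively. -/
theorem pos_bigon (h : Bigon a b p q) (hw : D.word = p ++ u ++ q ++ v) (o : Bool) :
    D.pos (a, o) = D.pos (b, !o) + 1 ∨ D.pos (b, !o) = D.pos (a, o) + 1 := by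
  have hn := D.nodup
  obtain ⟨s, rfl, rfl | rfl⟩ := h <;> rw [hw] at hn <;>
    obtain ⟨h1, h2, h3, h4, -⟩ := idxOf_insert_pairs hn <;> rw [← hw] at h1 h2 h3 h4 <;>
    rcases Bool.eq_or_eq_not o s with rfl | rfl <;>
    simp only [pos, Bool.not_not] at * <;> omega

/-- The corners of a bigon have parallel chords: no third chord ends between two consecutive
passages. The flip is there because the adjacent ends carry opposite signs. -/
theorem sameOrder_bigon (h : Bigon a b p q) (hw : D.word = p ++ u ++ q ++ v) {d : ℕ}
    (hda : d ≠ a) (hdb : d ≠ b) : SameOrder D.pos D.pos a d b d true := by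
  intro s t
  have h1 := pos_bigon h hw s
  have h2 := pos_ne (bigon_mem h hw).1 hda.symm s t
  have h3 := pos_ne (bigon_mem h hw).2 hdb.symm (!s) t
  simp only [Bool.true_xor]
  omega

/-- The two lower ends are consecutive, whereas the pattern would put them first and last with two
passages between. -/
theorem not_arfPair_bigon (h : Bigon a b p q) (hw : D.word = p ++ u ++ q ++ v) {t : ℕ → Bool}
    (ht : t b = !t a) : ¬ ArfPair D.pos t a b ∧ ¬ ArfPair D.pos t b a := by
  have h1 := pos_bigon h hw (t a)
  have h2 := pos_bigon h hw (!t a)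
  simp only [ArfPair, ht, Bool.not_not] at *
  omega

theorem crossings_insert_bigon (h : Bigon a b p q) (hw : D.word = u ++ v)
    (hw' : D'.word = p ++ u ++ q ++ v) : D'.crossings = insert a (insert b D.crossings) := by
  ext c
  obtain ⟨s, rfl, rfl | rfl⟩ := h
  · simp [crossings, hw, hw']
  · simp [crossings, hw, hw']
    grind

theorem notMem_crossings_insert_bigon (h : Bigon a b p q) (hw : D.word = u ++ v)
    (hw' : D'.word = p ++ u ++ q ++ v) : a ∉ D.crossings ∧ b ∉ D.crossings := by
  have hn := D'.nodup
  rw [hw'] at hn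
  obtain ⟨s, rfl, -⟩ := h
  rw [mem_crossings s, mem_crossings (!s), hw]
  simp at hn ⊢
  grind

theorem sameOrder_insert_bigon (h : Bigon a b p q) (hw : D.word = u ++ v)
    (hw' : D'.word = p ++ u ++ q ++ v) {d e : ℕ} (hd : d ∈ D.crossings) (he : e ∈ D.crossings) :
    SameOrder D.pos D'.pos d e d e false := by
  obtain ⟨ha, hb⟩ := notMem_crossings_insert_bigon h hw hw'
  have key : ∀ d ∈ D.crossings, ∀ s, (D.pos (d, s) < u.length ∧ D'.pos (d, s) = D.pos (d, s) + 2) ∨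
      (u.length ≤ D.pos (d, s) ∧ D'.pos (d, s) = D.pos (d, s) + 4) := by
    intro d hd s
    have hda : d ≠ a := fun h => ha (h ▸ hd)
    have hdb : d ≠ b := fun h => hb (h ▸ hd)
    have hn := D'.nodup
    rw [hw'] at hn
    simp only [pos, hw, hw']
    obtain ⟨s, rfl, rfl | rfl⟩ := h <;>
      exact (idxOf_insert_pairs hn).2.2.2.2 _ (by simp [hda]) (by simp [hdb]) (by simp [hda, hdb])
        (by simp [hda, hdb])
  intro s t
  have h1 := key d hd s
  have h2 := key e he t
  simp only [Bool.false_xor]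
  omega

theorem hasIntersectingPrechords_insert_bigon (h : Bigon a b p q) (hw : D.word = u ++ v)
    (hw' : D'.word = p ++ u ++ q ++ v) (hi : D'.info = D.info) (ha : D.info a ≠ none)
    (hb : D.info b ≠ none) :
    D'.HasIntersectingPrechords ↔ D.HasIntersectingPrechords := by
  simp only [hasIntersectingPrechords_iff, hi]
  have hmem : ∀ d ∈ D'.crossings, D.info d = none → d ∈ D.crossings := by
    intro d hd id
    rw [crossings_insert_bigon h hw hw', Finset.mem_insert, Finset.mem_insert] at hd
    rcases hd with rfl | rfl | hd
    · exact absurd id ha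
    · exact absurd id hb
    · exact hd
  have hmem' : ∀ d ∈ D.crossings, d ∈ D'.crossings := by
    intro d hd
    rw [crossings_insert_bigon h hw hw']
    exact Finset.mem_insert_of_mem (Finset.mem_insert_of_mem hd)
  constructor
  · rintro ⟨d, hd, e, he, id, ie, H⟩
    exact ⟨d, hmem d hd id, e, hmem e he ie, id, ie,
      (sameOrder_insert_bigon h hw hw' (hmem d hd id) (hmem e he ie)).interleaved_iff.2 H⟩
  · rintro ⟨d, hd, e, he, id, ie, H⟩
    exact ⟨d, hmem' d hd, e, hmem' e he, id, ie,
      (sameOrder_insert_bigon h hw hw' hd he).interleaved_iff.1 H⟩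

/-- Upper ends lie next to upper ends, so the two parallel chords pair equally with every other
chord and cancel modulo 2. -/
theorem arf_insert_bigon (h : Bigon a b p q) (hw : D.word = u ++ v)
    (hw' : D'.word = p ++ u ++ q ++ v) (hi : D'.info = D.info) (ht : D.top b = !D.top a) :
    D'.arf = D.arf := by
  obtain ⟨ha, hb⟩ := notMem_crossings_insert_bigon h hw hw'
  have hab := bigon_ne h hw'
  rw [arf, arf, crossings_insert_bigon h hw hw', top_congr hi, arfSum_insert _ _ (by simp [hab, ha]),
    arfSum_insert _ _ hb, Finset.sum_insert hb, if_neg (not_arfPair_bigon h hw' ht).1,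
    if_neg (not_arfPair_bigon h hw' ht).2, add_zero, zero_add, add_assoc, add_eq_left.2]
  · refine arfSum_congr fun d hd e he _ => ?_
    exact ((sameOrder_insert_bigon h hw hw' hd he).arfPair_iff (by simp) rfl).1.symm
  · refine Eq.trans ?_ (zmod_two_add_self (∑ d ∈ D.crossings,
      ((if ArfPair D'.pos D.top b d then 1 else 0) + if ArfPair D'.pos D.top d b then 1 else 0)))
    congr 1
    refine Finset.sum_congr rfl fun d hd => ?_
    have := (sameOrder_bigon h hw' (d := d) (fun h => ha (h ▸ hd))
      (fun h => hb (h ▸ hd))).arfPair_iff (t := D.top) (t' := D.top) (by simp [ht]) rfl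
    simp only [this.1, this.2]

/-- At most one corner is a prechord, so the intersecting pair is not the pair of corners, and a
corner can be replaced by its parallel. The symmetric hypothesis `hab` lets the lemma also serve the
reverse exchange. -/
theorem HasIntersectingPrechords.exchange (h : Bigon a b p q) (hw : D.word = p ++ u ++ q ++ v)
    (hw' : D'.word = D.word) (hi : D'.info = D.info ∘ Equiv.swap a b)
    (hab : D.info a ≠ none ∨ D.info b ≠ none) (H : D.HasIntersectingPrechords) :
    D'.HasIntersectingPrechords := by
  obtain ⟨c, hc, d, hd, ic, id, H⟩ := hasIntersectingPrechords_iff.1 H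
  have hV : D'.crossings = D.crossings := crossings_congr (by simp [hw'])
  have hpos : D'.pos = D.pos := by funext z; rw [pos, pos, hw']
  obtain ⟨ha, hb⟩ := bigon_mem h hw
  have hmem : ∀ x ∈ D.crossings, Equiv.swap a b x ∈ D.crossings := by
    intro x hx
    rw [Equiv.swap_apply_def]
    split_ifs <;> assumption
  refine hasIntersectingPrechords_iff.2 ⟨Equiv.swap a b c, hV ▸ hmem c hc, Equiv.swap a b d,
    hV ▸ hmem d hd, by simp [hi, ic], by simp [hi, id], ?_⟩
  have hcd := H.ne
  have key : ∀ c d, c ≠ d → D.info c = none → D.info d = none → Interleaved D.pos c d →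
      (c = a ∨ c = b) → Interleaved D.pos (Equiv.swap a b c) (Equiv.swap a b d) := by
    rintro c d hcd ic id H (rfl | rfl)
    · have hdb : d ≠ b := by
        rintro rfl
        rcases hab with h | h
        · exact h ic
        · exact h id
      rw [Equiv.swap_apply_left, Equiv.swap_apply_of_ne_of_ne hcd.symm hdb]
      exact (sameOrder_bigon h hw hcd.symm hdb).interleaved_iff.1 H
    · have hda : d ≠ a := by
        rintro rfl
        rcases hab with h | h
        · exact h id
        · exact h ic
      rw [Equiv.swap_apply_right, Equiv.swap_apply_of_ne_of_ne hda hcd.symm]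
      exact (sameOrder_bigon h hw hda hcd.symm).interleaved_iff.2 H
  rw [hpos]
  by_cases h1 : c = a ∨ c = b
  · exact key c d hcd ic id H h1
  by_cases h2 : d = a ∨ d = b
  · exact (key d c hcd.symm id ic H.symm h2).symm
  push Not at h1 h2
  rwa [Equiv.swap_apply_of_ne_of_ne h1.1 h1.2, Equiv.swap_apply_of_ne_of_ne h2.1 h2.2]

theorem hasIntersectingPrechords_exchange (h : Bigon a b p q) (hw : D.word = p ++ u ++ q ++ v)
    (hw' : D'.word = D.word) (hi : D'.info = D.info ∘ Equiv.swap a b) (hb : D.info b ≠ none) :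
    D'.HasIntersectingPrechords ↔ D.HasIntersectingPrechords := by
  refine ⟨?_, .exchange h hw hw' hi (Or.inr hb)⟩
  refine .exchange h (hw'.trans hw) hw'.symm ?_ (Or.inl (by simpa [hi] using hb))
  funext x
  simp [hi]

end Bigon

end Pseudodiagram

/-! ### The moves R3 and PR3. -/

/-- The position, among the six passages through the corners of a triangle, of the passage `s`
through the corner `i`.  The strand of the first side comes first, `o` tells in which order the
strands of the two other sides are met, and `φ` whether the strands have been reversed. -/
def triangleSlot (e₁ e₂ e₃ o φ : Bool) (i : Fin 3) (s : Bool) : ℕ :=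
  let q := if o then 2 else 4
  let r := if o then 4 else 2
  match i with
  | 0 => if s = !(xor e₁ e₂) then (xor e₁ φ).toNat else q + (!(xor e₂ φ)).toNat
  | 1 => if s = !(xor e₂ e₃) then q + (xor e₂ φ).toNat else r + (!(xor e₃ φ)).toNat
  | 2 => if s = xor e₃ e₁ then (!(xor e₁ φ)).toNat else r + (xor e₃ φ).toNat

/-- The Arf invariant of three chords. -/
def arfThree (F : Fin 3 → Bool → ℕ) (τ : Fin 3 → Bool) : ZMod 2 :=
  ∑ i, ∑ j, if F i (!τ i) < F j (τ j) ∧ F j (τ j) < F i (τ i) ∧ F i (τ i) < F j (!τ j)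
    then 1 else 0

theorem triangleSlot_lt (e₁ e₂ e₃ o φ : Bool) (i : Fin 3) (s : Bool) :
    triangleSlot e₁ e₂ e₃ o φ i s < 6 := by
  revert e₁ e₂ e₃ o φ i s; decide

theorem triangleSlot_injective (e₁ e₂ e₃ o φ : Bool) :
    Function.Injective (triangleSlot e₁ e₂ e₃ o φ) := by
  have : ∀ e₁ e₂ e₃ o φ i j, (∀ s, triangleSlot e₁ e₂ e₃ o φ i s = triangleSlot e₁ e₂ e₃ o φ j s) →
      i = j := by decide
  exact fun i j h => this e₁ e₂ e₃ o φ i j (congrFun h)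

/-- A check of the 64 cases. The moving strand is the upper one at both its corners for `x = false`
and the lower one for `x = true`; the value `y` at the third corner is free. -/
theorem arfThree_triangleSlot (e₁ e₂ e₃ o x y : Bool) :
    arfThree (triangleSlot e₁ e₂ e₃ o true)
        ![xor x (!(xor e₁ e₂)), y, xor x (xor e₃ e₁)] =
      arfThree (triangleSlot e₁ e₂ e₃ o false)
        ![xor x (!(xor e₁ e₂)), y, xor x (xor e₃ e₁)] := by
  cases e₁ <;> cases e₂ <;> cases e₃ <;> cases o <;> cases x <;> cases y <;> decide

theorem arfSum_image_fin_three {f : Pass → ℕ} {t : ℕ → Bool} {m : Fin 3 → ℕ}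
    (hm : Function.Injective m) {ι : ℕ → ℕ} (hι : ∀ k < 6, ∀ l < 6, (ι k < ι l ↔ k < l))
    {F : Fin 3 → Bool → ℕ} (hF : ∀ i s, F i s < 6) (hf : ∀ i s, f (m i, s) = ι (F i s)) :
    arfSum f t (Finset.univ.image m) = arfThree F (t ∘ m) := by
  rw [arfSum, Finset.sum_image hm.injOn, arfThree]
  refine Finset.sum_congr rfl fun i _ => ?_
  rw [Finset.sum_image hm.injOn]
  refine Finset.sum_congr rfl fun j _ => ?_
  simp only [ArfPair, hf, hι _ (hF _ _) _ (hF _ _), Function.comp_apply]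

theorem arfSum_eq_of_subset {f g : Pass → ℕ} {t : ℕ → Bool} {V T : Finset ℕ} (hT : T ⊆ V)
    (h : ∀ c ∈ V, ∀ d ∈ V, ¬ (c ∈ T ∧ d ∈ T) → (ArfPair f t c d ↔ ArfPair g t c d))
    (hs : arfSum f t T = arfSum g t T) : arfSum f t V = arfSum g t V := by
  have expand : ∀ S : Finset ℕ, arfSum f t S - arfSum g t S = ∑ x ∈ S ×ˢ S,
      ((if ArfPair f t x.1 x.2 then (1 : ZMod 2) else 0) - if ArfPair g t x.1 x.2 then 1 else 0) := by
    intro S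
    rw [Finset.sum_sub_distrib, Finset.sum_product, Finset.sum_product, arfSum, arfSum]
  rw [← sub_eq_zero] at hs ⊢
  rw [expand] at hs ⊢
  refine Eq.trans (Eq.symm ?_) hs
  refine Finset.sum_subset (Finset.product_subset_product hT hT) ?_
  rintro ⟨c, d⟩ hV hn
  rw [Finset.mem_product] at hV hn
  simp only [h c hV.1 d hV.2 hn, sub_self]

namespace Pseudodiagram

variable {D D' : Pseudodiagram}

section Slide

theorem strand_eq (e : Bool) (x y : Pass) :
    strand e x y = [bif e then x else y, bif e then y else x] := by
  cases e <;> rfl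

theorem strand_reverse (e : Bool) (x y : Pass) :
    (strand e x y).reverse = strand (xor e true) x y := by
  cases e <;> rfl

/-- Reversing a block of two consecutive passages moves neither of them past a passage outside the
block. -/
theorem pos_lt_pos_of_three_pairs {p₁ p₂ q₁ q₂ r₁ r₂ : Pass} {u v w : List Pass}
    (hw : D.word = [p₁, p₂] ++ u ++ [q₁, q₂] ++ v ++ [r₁, r₂] ++ w)
    (hw' : D'.word = [p₂, p₁] ++ u ++ [q₂, q₁] ++ v ++ [r₂, r₁] ++ w)
    {x y : Pass} (hx : x ∈ D.word) (hxn : x ∉ [p₁, p₂, q₁, q₂, r₁, r₂]) :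
    (D.pos x < D.pos y ↔ D'.pos x < D'.pos y) ∧ (D.pos y < D.pos x ↔ D'.pos y < D'.pos x) := by
  have hn := D.nodup
  have hn' := D'.nodup
  rw [hw] at hn
  rw [hw'] at hn'
  obtain ⟨a1, a2, a3, a4, a5, a6⟩ := idxOf_three_pairs hn
  obtain ⟨b1, b2, b3, b4, b5, b6⟩ := idxOf_three_pairs hn'
  have key : ∀ z, z ∉ [p₁, p₂, q₁, q₂, r₁, r₂] → D.pos z = D'.pos z := by
    intro z hz
    simp only [List.mem_cons, List.not_mem_nil, or_false, not_or] at hz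
    rw [pos, pos, hw, hw']
    exact idxOf_swap_three_pairs hz.1 hz.2.1 hz.2.2.1 hz.2.2.2.1 hz.2.2.2.2.1 hz.2.2.2.2.2
  have hne : ∀ z, z ∈ [p₁, p₂, q₁, q₂, r₁, r₂] → D.pos x ≠ D.pos z := by
    intro z hz h
    exact hxn (pos_inj hx h ▸ hz)
  have c1 := hne p₁ (by simp)
  have c2 := hne p₂ (by simp)
  have c3 := hne q₁ (by simp)
  have c4 := hne q₂ (by simp)
  have c5 := hne r₁ (by simp)
  have c6 := hne r₂ (by simp)
  rw [← hw] at a1 a2 a3 a4 a5 a6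
  rw [← hw'] at b1 b2 b3 b4 b5 b6
  have hxk := key x hxn
  by_cases hy : y ∈ [p₁, p₂, q₁, q₂, r₁, r₂]
  · simp only [List.mem_cons, List.not_mem_nil, or_false] at hy
    simp only [pos] at *
    rcases hy with rfl | rfl | rfl | rfl | rfl | rfl <;> omega
  · rw [hxk, key y hy]
    simp

/-- Positions of three pairs of consecutive passages, with `m` and `n` passages between them. -/
def pairSlot (m n : ℕ) : ℕ → ℕ
  | 0 => 0
  | 1 => 1
  | 2 => m + 2
  | 3 => m + 3
  | 4 => m + n + 4
  | _ => m + n + 5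

theorem pairSlot_lt_iff (m n : ℕ) : ∀ k < 6, ∀ l < 6, (pairSlot m n k < pairSlot m n l ↔ k < l) := by
  intro k hk l hl
  interval_cases k <;> interval_cases l <;> simp only [pairSlot] <;> omega

theorem apply_triangleSlot {f : Pass → ℕ} {a b c : ℕ} {e₁ e₂ e₃ φ o : Bool} {ι : ℕ → ℕ}
    (h1 : f (bif xor e₁ φ then (c, xor e₃ e₁) else (a, !(xor e₁ e₂))) = ι 0)
    (h2 : f (bif xor e₁ φ then (a, !(xor e₁ e₂)) else (c, xor e₃ e₁)) = ι 1)
    (h3 : f (bif xor e₂ φ then (a, xor e₁ e₂) else (b, !(xor e₂ e₃))) = ι (if o then 2 else 4))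
    (h4 : f (bif xor e₂ φ then (b, !(xor e₂ e₃)) else (a, xor e₁ e₂)) = ι (if o then 3 else 5))
    (h5 : f (bif xor e₃ φ then (b, xor e₂ e₃) else (c, !(xor e₃ e₁))) = ι (if o then 4 else 2))
    (h6 : f (bif xor e₃ φ then (c, !(xor e₃ e₁)) else (b, xor e₂ e₃)) = ι (if o then 5 else 3))
    (i : Fin 3) (s : Bool) :
    f ((![a, b, c] : Fin 3 → ℕ) i, s) = ι (triangleSlot e₁ e₂ e₃ o φ i s) := by
  cases e₁ <;> cases e₂ <;> cases e₃ <;> cases φ <;> cases o <;> cases s <;> fin_cases i <;>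
    first | exact h1 | exact h2 | exact h3 | exact h4 | exact h5 | exact h6

theorem pos_triangle {a b c : ℕ} {e₁ e₂ e₃ φ : Bool} {u v w : List Pass}
    (hw : D.word = strand (xor e₁ φ) (c, xor e₃ e₁) (a, !(xor e₁ e₂)) ++ u ++
      strand (xor e₂ φ) (a, xor e₁ e₂) (b, !(xor e₂ e₃)) ++ v ++
      strand (xor e₃ φ) (b, xor e₂ e₃) (c, !(xor e₃ e₁)) ++ w) (i : Fin 3) (s : Bool) :
    D.pos ((![a, b, c] : Fin 3 → ℕ) i, s) =
      pairSlot u.length v.length (triangleSlot e₁ e₂ e₃ true φ i s) := by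
  have hn := D.nodup
  simp only [strand_eq] at hw
  rw [hw] at hn
  obtain ⟨a1, a2, a3, a4, a5, a6⟩ := idxOf_three_pairs hn
  rw [← hw] at a1 a2 a3 a4 a5 a6
  exact apply_triangleSlot a1 a2 a3 a4 a5 a6 i s

theorem pos_triangle_swapped {a b c : ℕ} {e₁ e₂ e₃ φ : Bool} {u v w : List Pass}
    (hw : D.word = strand (xor e₁ φ) (c, xor e₃ e₁) (a, !(xor e₁ e₂)) ++ u ++
      strand (xor e₃ φ) (b, xor e₂ e₃) (c, !(xor e₃ e₁)) ++ v ++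
      strand (xor e₂ φ) (a, xor e₁ e₂) (b, !(xor e₂ e₃)) ++ w) (i : Fin 3) (s : Bool) :
    D.pos ((![a, b, c] : Fin 3 → ℕ) i, s) =
      pairSlot u.length v.length (triangleSlot e₁ e₂ e₃ false φ i s) := by
  have hn := D.nodup
  simp only [strand_eq] at hw
  rw [hw] at hn
  obtain ⟨a1, a2, a3, a4, a5, a6⟩ := idxOf_three_pairs hn
  rw [← hw] at a1 a2 a3 a4 a5 a6
  exact apply_triangleSlot a1 a2 a5 a6 a3 a4 i s

theorem sameOrder_of_three_pairs {e₁ e₂ e₃ : Bool} {p₁ p₂ q₁ q₂ r₁ r₂ : Pass}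
    {u v w : List Pass}
    (hw : D.word = strand e₁ p₁ p₂ ++ u ++ strand e₂ q₁ q₂ ++ v ++ strand e₃ r₁ r₂ ++ w)
    (hw' : D'.word = (strand e₁ p₁ p₂).reverse ++ u ++ (strand e₂ q₁ q₂).reverse ++ v ++
      (strand e₃ r₁ r₂).reverse ++ w)
    {d : ℕ} (hd : d ∈ D.crossings) (h : ∀ z ∈ [p₁, p₂, q₁, q₂, r₁, r₂], d ≠ z.1) (e : ℕ) :
    SameOrder D.pos D'.pos d e d e false := by
  intro s t
  simp only [strand_eq] at hw hw'
  simp only [Bool.false_xor]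
  refine pos_lt_pos_of_three_pairs hw hw' (mem_word hd s) ?_
  intro hz
  have : (d, s) ∈ [p₁, p₂, q₁, q₂, r₁, r₂] := by
    cases e₁ <;> cases e₂ <;> cases e₃ <;> simp at hz ⊢ <;> tauto
  exact h _ this rfl

/-- The change of the Gauss diagram in a slide across a triangle. -/
theorem Slide.exists_slots {b : ℕ} (h : Slide b D D') :
    D'.info = D.info ∧ ∃ (a c : ℕ) (e₁ e₂ e₃ o x : Bool) (ι : ℕ → ℕ),
      D.info a = some (xor x (!(xor e₁ e₂))) ∧ D.info c = some (xor x (xor e₃ e₁)) ∧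
      (∀ k < 6, ∀ l < 6, (ι k < ι l ↔ k < l)) ∧
      (∀ i, (![a, b, c] : Fin 3 → ℕ) i ∈ D.crossings) ∧
      (∀ i s, D.pos ((![a, b, c] : Fin 3 → ℕ) i, s) = ι (triangleSlot e₁ e₂ e₃ o false i s)) ∧
      (∀ i s, D'.pos ((![a, b, c] : Fin 3 → ℕ) i, s) = ι (triangleSlot e₁ e₂ e₃ o true i s)) ∧
      D'.crossings = D.crossings ∧
      ∀ d ∈ D.crossings, (∀ i, d ≠ (![a, b, c] : Fin 3 → ℕ) i) →
        ∀ e, SameOrder D.pos D'.pos d e d e false := by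
  obtain ⟨hi, a, c, p, q, r, u, v, w, ⟨e₁, e₂, e₃, rfl, rfl, rfl, hinfo⟩, hw⟩ := h
  obtain ⟨x, ha, hc⟩ : ∃ x, D.info a = some (xor x (!(xor e₁ e₂))) ∧
      D.info c = some (xor x (xor e₃ e₁)) := by
    rcases hinfo with h | h
    · exact ⟨false, by simp [h.1, h.2]⟩
    · exact ⟨true, by simp [h.1, h.2]⟩
  have hV : D'.crossings = D.crossings := by
    refine crossings_congr fun z => ?_
    rcases hw with ⟨hw, hw'⟩ | ⟨hw, hw'⟩ <;> simp [hw, hw']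
  have hmem : ∀ i, (![a, b, c] : Fin 3 → ℕ) i ∈ D.crossings := by
    intro i
    fin_cases i
    · refine (mem_crossings (xor e₁ e₂)).2 ?_
      rcases hw with ⟨hw, -⟩ | ⟨hw, -⟩ <;> rw [hw] <;> cases e₂ <;> simp [strand]
    · refine (mem_crossings (xor e₂ e₃)).2 ?_
      rcases hw with ⟨hw, -⟩ | ⟨hw, -⟩ <;> rw [hw] <;> cases e₃ <;> simp [strand]
    · refine (mem_crossings (xor e₃ e₁)).2 ?_
      rcases hw with ⟨hw, -⟩ | ⟨hw, -⟩ <;> rw [hw] <;> cases e₁ <;> simp [strand]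
  have hfin : ∀ d, (∀ i, d ≠ (![a, b, c] : Fin 3 → ℕ) i) → d ≠ a ∧ d ≠ b ∧ d ≠ c :=
    fun d h => ⟨h 0, h 1, h 2⟩
  rcases hw with ⟨hw, hw'⟩ | ⟨hw, hw'⟩
  · refine ⟨hi, a, c, e₁, e₂, e₃, true, x, pairSlot u.length v.length, ha, hc,
      pairSlot_lt_iff _ _, hmem, pos_triangle (w := w) (by simpa using hw),
      pos_triangle (w := w) (by simpa only [strand_reverse] using hw'), hV, ?_⟩
    intro d hd hdn e
    obtain ⟨h1, h2, h3⟩ := hfin d hdn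
    exact sameOrder_of_three_pairs hw hw' hd (by simp [h1, h2, h3]) e
  · refine ⟨hi, a, c, e₁, e₂, e₃, false, x, pairSlot u.length v.length, ha, hc,
      pairSlot_lt_iff _ _, hmem, pos_triangle_swapped (w := w) (by simpa using hw),
      pos_triangle_swapped (w := w) (by simpa only [strand_reverse] using hw'), hV, ?_⟩
    intro d hd hdn e
    obtain ⟨h1, h2, h3⟩ := hfin d hdn
    exact sameOrder_of_three_pairs hw hw' hd (by simp [h1, h2, h3]) e

/-- The corners `a` and `c` are classical, so two distinct prechords include at most one corner,
namely `b`, and the slide preserves its order relative to chords outside the triangle. -/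
theorem hasIntersectingPrechords_slide {b : ℕ} (h : Slide b D D') :
    D'.HasIntersectingPrechords ↔ D.HasIntersectingPrechords := by
  obtain ⟨hi, a, c, e₁, e₂, e₃, o, x, ι, ha, hc, -, -, -, -, hV, hS⟩ := h.exists_slots
  refine HasIntersectingPrechords.congr hV hi fun d hd e he hde id ie => ?_
  have key : ∀ d, D.info d = none → d ≠ b → ∀ i, d ≠ (![a, b, c] : Fin 3 → ℕ) i := by
    intro d id hdb i
    fin_cases i
    · rintro rfl
      simp [ha] at id
    · exact hdb
    · rintro rfl
      simp [hc] at id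
  by_cases hdb : d = b
  · have := hS e he (key e ie (by rintro rfl; exact hde hdb)) d
    rw [interleaved_comm, interleaved_comm (f := D.pos)]
    exact this.interleaved_iff.symm
  · exact (hS d hd (key d id hdb) e).interleaved_iff.symm

theorem arf_slide {b : ℕ} (h : Slide b D D') : D'.arf = D.arf := by
  obtain ⟨hi, a, c, e₁, e₂, e₃, o, x, ι, ha, hc, hι, hmem, hp, hp', hV, hS⟩ := h.exists_slots
  set m : Fin 3 → ℕ := ![a, b, c] with hm
  -- The corners are distinct because they occupy different slots.
  have hinj : Function.Injective m := by
    intro i j hij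
    refine triangleSlot_injective e₁ e₂ e₃ o false (funext fun s => ?_)
    have h := hp i s
    rw [hij, hp j s] at h
    have h1 := hι _ (triangleSlot_lt e₁ e₂ e₃ o false i s) _ (triangleSlot_lt e₁ e₂ e₃ o false j s)
    have h2 := hι _ (triangleSlot_lt e₁ e₂ e₃ o false j s) _ (triangleSlot_lt e₁ e₂ e₃ o false i s)
    omega
  have htop : D.top ∘ m = ![xor x (!(xor e₁ e₂)), D.top b, xor x (xor e₃ e₁)] := by
    funext i
    fin_cases i
    · simp [hm, top, ha]
    · rfl
    · simp [hm, top, hc]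
  rw [arf, arf, hV, top_congr hi]
  refine arfSum_eq_of_subset (T := Finset.univ.image m) ?_ ?_ ?_
  · intro d hd
    obtain ⟨i, -, rfl⟩ := Finset.mem_image.1 hd
    exact hmem i
  · intro d hd e he hde
    by_cases hdT : d ∈ Finset.univ.image m
    · have heT : ∀ i, e ≠ m i := by
        rintro i rfl
        exact hde ⟨hdT, by simp⟩
      exact ((hS e he heT d).arfPair_iff (t := D.top) (t' := D.top) (by simp) rfl).2.symm
    · have hdT' : ∀ i, d ≠ m i := by
        rintro i rfl
        exact hdT (by simp)
      exact ((hS d hd hdT' e).arfPair_iff (t := D.top) (t' := D.top) (by simp) rfl).1.symm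
  · rw [arfSum_image_fin_three hinj hι (triangleSlot_lt _ _ _ _ _) hp,
      arfSum_image_fin_three hinj hι (triangleSlot_lt _ _ _ _ _) hp', htop]
    exact arfThree_triangleSlot e₁ e₂ e₃ o x _

end Slide

end Pseudodiagram

/-! ### A resolution with nonzero Arf invariant. -/

/-- The second difference of the Arf invariant over two intersecting chords is nonzero. -/
theorem sum_arfSum_eq_one {f : Pass → ℕ} {V : Finset ℕ} {c d : ℕ} (hc : c ∈ V) (hd : d ∈ V)
    (h : Interleaved f c d) (t : Bool → Bool → ℕ → Bool) (htc : ∀ i j, t i j c = i)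
    (htd : ∀ i j, t i j d = j) (ht : ∀ i j x, x ≠ c → t i j x = t true j x)
    (ht' : ∀ i j x, x ≠ d → t i j x = t i true x) :
    ∑ i, ∑ j, arfSum f (t i j) V = 1 := by
  have hcd := h.ne
  have expand : ∀ S : Finset ℕ, ∑ i, ∑ j, arfSum f (t i j) S =
      ∑ x ∈ S ×ˢ S, ∑ i, ∑ j, if ArfPair f (t i j) x.1 x.2 then (1 : ZMod 2) else 0 := by
    intro S
    simp only [Fintype.sum_bool, Finset.sum_add_distrib, Finset.sum_product, arfSum]
  have hT : ({c, d} : Finset ℕ) ⊆ V := by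
    intro x hx
    rw [Finset.mem_insert, Finset.mem_singleton] at hx
    rcases hx with rfl | rfl <;> assumption
  have hsub : ∑ i, ∑ j, arfSum f (t i j) ({c, d} : Finset ℕ) = ∑ i, ∑ j, arfSum f (t i j) V := by
    rw [expand, expand]
    refine Finset.sum_subset (Finset.product_subset_product hT hT) ?_
    rintro ⟨x, y⟩ - hn
    by_cases hxy : x = y
    · subst hxy
      simp only [if_neg (not_arfPair_self f _ x), Finset.sum_const_zero]
    -- A pair that avoids `c` does not depend on `i`, so it is counted twice. A pair that involves
    -- `c` but is not contained in `{c, d}` avoids `d`, and the same holds for `j`.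
    by_cases hx : x ≠ c ∧ y ≠ c
    · have : ∀ i j, ArfPair f (t i j) x y ↔ ArfPair f (t true j) x y := by
        intro i j
        simp only [ArfPair, ht i j x hx.1, ht i j y hx.2]
      simp only [this]
      rw [Fintype.sum_bool, zmod_two_add_self]
    · have hy : x ≠ d ∧ y ≠ d := by
        simp only [Finset.mem_product, Finset.mem_insert, Finset.mem_singleton] at hn
        grind
      have : ∀ i j, ArfPair f (t i j) x y ↔ ArfPair f (t i true) x y := by
        intro i j
        simp only [ArfPair, ht' i j x hy.1, ht' i j y hy.2]
      simp only [this]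
      rw [Finset.sum_comm, Fintype.sum_bool, zmod_two_add_self]
  rw [← hsub]
  have hpair : ∀ i j, arfSum f (t i j) ({c, d} : Finset ℕ) =
      (if f (c, !i) < f (d, j) ∧ f (d, j) < f (c, i) ∧ f (c, i) < f (d, !j) then 1 else 0) +
      (if f (d, !j) < f (c, i) ∧ f (c, i) < f (d, j) ∧ f (d, j) < f (c, !i) then 1 else 0) := by
    intro i j
    simp only [arfSum, Finset.sum_pair hcd, if_neg (not_arfPair_self f _ _), zero_add, add_zero]
    simp only [ArfPair, htc, htd]
  simp only [hpair, Fintype.sum_bool, Bool.not_true, Bool.not_false]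
  -- The four ends alternate, so once the first is made a lower passage and the second an upper one
  -- the whole pattern is forced: exactly one of the four choices counts.
  obtain ⟨s, u, h⟩ := h
  cases s <;> cases u <;> simp only [Bool.not_true, Bool.not_false] at h <;>
    rcases h with ⟨h1, h2, h3⟩ | ⟨h1, h2, h3⟩ <;>
    (repeat' first | rw [if_pos (by omega)] | rw [if_neg (by omega)]) <;> decide

namespace Pseudodiagram

variable {D D' : Pseudodiagram}

theorem HasIntersectingPrechords.exists_resolve (h : D.HasIntersectingPrechords) :
    ∃ r : ℕ → Bool, (D.resolve r).arf ≠ 0 := by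
  obtain ⟨c, hc, d, hd, ic, id, h⟩ := hasIntersectingPrechords_iff.1 h
  by_contra! H
  -- The value `true` away from `c` and `d` is arbitrary; it only has to be the same in all four
  -- resolutions.
  let r : Bool → Bool → ℕ → Bool := fun i j =>
    Function.update (Function.update (fun _ => true) c i) d j
  have := sum_arfSum_eq_one hc hd h (fun i j => (D.resolve (r i j)).top)
    (fun i j => by simp [top, resolve, ic, r, Function.update_of_ne h.ne])
    (fun i j => by simp [top, resolve, id, r])
    (fun i j x hx => by simp [top, resolve, r, Function.update_apply, hx])
    (fun i j x hx => by simp [top, resolve, r, Function.update_apply, hx])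
  have hz : ∀ i j, arfSum D.pos (D.resolve (r i j)).top D.crossings = 0 := fun i j => H (r i j)
  simp [hz] at this

/-! ### Invariance along sequences of moves, and the conclusion. -/

theorem arf_sameDiagram (h : SameDiagram D D') : D'.arf = D.arf := by
  cases h with
  | rotate hw hi => exact arf_isRotated hw hi
  | reverse hw hi => exact arf_reverse hw hi
  | rename m hw hi => exact arf_rename hw hi

theorem arf_reidemeisterMove (h : ReidemeisterMove D D') : D'.arf = D.arf := by
  cases h with
  | r1 c s hi hc hw => exact arf_loop hw hi
  | r2 a b o p q u v hi ha hb hpq hw hw' =>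
    exact arf_insert_bigon hpq hw hw' hi (by simp [top, ha, hb])
  | r3 b hb h => exact arf_slide h

theorem KnotEquiv.arf_eq (h : KnotEquiv D D') : D.arf = D'.arf := by
  induction h with
  | rel _ _ h =>
    rcases h with h | h
    · exact (arf_sameDiagram h).symm
    · exact (arf_reidemeisterMove h).symm
  | refl => rfl
  | symm _ _ _ ih => exact ih.symm
  | trans _ _ _ _ _ ih₁ ih₂ => exact ih₁.trans ih₂

theorem hasIntersectingPrechords_sameDiagram (h : SameDiagram D D') :
    D'.HasIntersectingPrechords ↔ D.HasIntersectingPrechords := by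
  cases h with
  | rotate hw hi => exact hasIntersectingPrechords_isRotated hw hi
  | reverse hw hi => exact hasIntersectingPrechords_reverse hw hi
  | rename m hw hi => exact hasIntersectingPrechords_rename hw hi

theorem hasIntersectingPrechords_reidemeisterMove (h : ReidemeisterMove D D') :
    D'.HasIntersectingPrechords ↔ D.HasIntersectingPrechords := by
  cases h with
  | r1 c s hi hc hw => exact hasIntersectingPrechords_loop hw hi
  | r2 a b o p q u v hi ha hb hpq hw hw' =>
    exact hasIntersectingPrechords_insert_bigon hpq hw hw' hi (by simp [ha]) (by simp [hb])
  | r3 b hb h => exact hasIntersectingPrechords_slide h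

theorem hasIntersectingPrechords_precrossingMove (h : PrecrossingMove D D') :
    D'.HasIntersectingPrechords ↔ D.HasIntersectingPrechords := by
  cases h with
  | pr1 c s hi hc hw => exact hasIntersectingPrechords_loop hw hi
  | pr2 a b p q u v ha hb hpq hw hw' hi => exact hasIntersectingPrechords_exchange hpq hw hw' hi hb
  | pr3 b hb h => exact hasIntersectingPrechords_slide h

theorem hasIntersectingPrechords_crossingChange (h : CrossingChange D D') :
    D'.HasIntersectingPrechords ↔ D.HasIntersectingPrechords := by
  obtain ⟨c, s, hc, hw, hi⟩ := h
  have hV : D'.crossings = D.crossings := crossings_congr (by simp [hw])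
  have hpos : D'.pos = D.pos := by funext z; rw [pos, pos, hw]
  have hnone : ∀ d, D'.info d = none ↔ D.info d = none := by
    intro d
    rw [hi, Function.update_apply]
    split_ifs with h
    · simp [h, hc]
    · rfl
  simp only [hasIntersectingPrechords_iff, hV, hpos, hnone]

theorem Homotopic.hasIntersectingPrechords_iff (h : Homotopic D D') :
    D.HasIntersectingPrechords ↔ D'.HasIntersectingPrechords := by
  induction h with
  | rel _ _ h =>
    rcases h with h | h | h | h
    · exact (hasIntersectingPrechords_sameDiagram h).symm
    · exact (hasIntersectingPrechords_reidemeisterMove h).symm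
    · exact (hasIntersectingPrechords_precrossingMove h).symm
    · exact (hasIntersectingPrechords_crossingChange h).symm
  | refl => rfl
  | symm _ _ _ ih => exact ih.symm
  | trans _ _ _ _ _ ih₁ ih₂ => exact ih₁.trans ih₂

theorem PseudoEquiv.homotopic (h : PseudoEquiv D D') : Homotopic D D' :=
  Relation.EqvGen.mono (fun _ _ h => Or.imp_right (Or.imp_right Or.inl) h) _ _ h

theorem not_hasIntersectingPrechords_unknot : ¬ unknot.HasIntersectingPrechords := by
  rintro ⟨c, d, ⟨h, -⟩, -⟩
  simp [unknot] at h

theorem arf_unknot : unknot.arf = 0 := rfl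

end Pseudodiagram

theorem mainTheorem8 (K K' : Pseudodiagram) (hK : K.HasIntersectingPrechords)
    (h : Pseudodiagram.Homotopic K K') :
    ¬ Pseudodiagram.PseudoEquiv K' Pseudodiagram.unknot ∧
      (∃ r : ℕ → Bool, ¬ Pseudodiagram.KnotEquiv (K'.resolve r) Pseudodiagram.unknot) ∧
      K'.HasIntersectingPrechords := by
  have hK' := h.hasIntersectingPrechords_iff.1 hK
  refine ⟨fun he => ?_, ?_, hK'⟩
  · exact Pseudodiagram.not_hasIntersectingPrechords_unknot
      (he.homotopic.hasIntersectingPrechords_iff.1 hK')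
  · obtain ⟨r, hr⟩ := hK'.exists_resolve
    exact ⟨r, fun he => hr (he.arf_eq.trans Pseudodiagram.arf_unknot)⟩
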